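/- **Setting.** An adaptive adversary issues operations: it inserts a new point, deletes a current point, asks a value-query, or asks a solution-query. While processing an operation, a dynamic algorithm may query distances between any points inserted so far (deleted or not). At every time, all reported distances must agree with some metric of aspect ratio at most $\Delta$ on the set of all points inserted so far; such a metric is called consistent. The adversary's next move may depend on everything that has happened so far. The algorithm knows $k$ and $\Delta$ and may compute arbitrarily. Let $P$ be the set of current points and $n=|P|$. The centers, both those of the algorithm and those of the optimum, come from a pool, which is either $P$ or the set of all points inserted so far; the results hold for each of the two choices. For a center set $C$, the cost is $\max_{x\in P}d(x,C)$ for $k$-center, $\sum_{x\in P}d(x,C)$ for $k$-median, $\sum_{x\in P} d(x,C)^2$ for $k$-means and $\sum_{x\in P}d(x,C)^p$ for $(k,p)$-clustering, $p\ge 1$ real. For $k$-sum-of-radii a solution is a set of balls with centers in the pool that covers $P$, its cost being the sum of the radii; for $k$-sum-of-diameters it is a partition of $P$ into clusters (counted as centers), its cost being the sum of the diameters. $\mathrm{OPT}$ is the least cost of a solution with at most $k$ centers. The algorithm has approximation ratio $\alpha(n)$ with at most $g$ centers if, for every consistent metric, each answer $\mathsf{apx}$ to a value-query satisfies $\mathrm{OPT}\le\mathsf{apx}\le\alpha(n)\,\mathrm{OPT}$,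 and each answer to a solution-query is a feasible solution with at most $g$ centers and cost at most $\alpha(n)\,\mathrm{OPT}$. It makes amortized at most $F(n)$ distance queries per operation if at any time the total number of its distance queries is at most $\sum_i F(n_i)$, the sum being over all operations so far, where $n_i$ is the number of current points at the beginning of the $i$-th operation. Logarithms are to base $2$. **Theorem 2.5.** Let $f(k,n)\ge 1$ be non-decreasing in $n$ for every $k$, let $k\ge1$ and $B$ be natural numbers, and consider dynamic algorithms that make amortized at most $f(k,n)$ distance queries per operation and output at most $Bk$ centers. There are constants $c$ and $N$ as specified below such that, for every $m\ge N$ and every $\Delta\ge m$, the adversary has one strategy (depending on the problem, but not on the algorithm) against which every such algorithm with approximation ratio $\alpha$ satisfies, for some $n\in[m,4m]$: 1. $\alpha(n)\ge c\cdot\dfrac{\log n}{\log f(k,2n)}$ for $k$-center, $k$-sum-of-radii and $k$-sum-of-diameters, provided that $f(k,m)\ge b$, where $b>1$ is any fixed constant; $c>0$ depends only on $b$, and $N$ only on $b,k,B$; 2. $\alpha(n)\ge c\cdot\dfrac{\log n}{10+2\log f(k,2n)}$ for $k$-median; 3. $\alpha(n)\ge c\left(\dfrac{\log n}{12+2\log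 f(k,2n)}\right)^{2}$ for $k$-means; 4. $\alpha(n)\ge c\left(\dfrac{\log n}{2p+8+2\log f(k,2n)}\right)^{p}$ for $(k,p)$-clustering, for every real $p\ge1$. In 2–4, $c>0$ is an absolute constant and $N$ depends only on $k$ and $B$, and these bounds hold even if nothing is required of the answers to value-queries. For $k=1$ the bounds are in terms of $f(1,2n)$; so an algorithm for arbitrary $k$ has these lower bounds on its ratio already on instances with $k=1$. Consequently, for none of these problems is there an $O(1)$-approximation with $n^{o(1)}h(k)$ distance queries (and hence none with update time $n^{o(1)}h(k)$): if $e(n)\to0$, $h$ is an arbitrary function, and $f$ is any real function, not necessarily monotone or at least $1$, with $f(k,n)\le h(k)\,n^{e(n)}$ for all $k$ and all $n\ge1$, then for all $k\ge1$, $B$ and every constant $a$ there are a $\Delta$ and a strategy of the adversary against which no algorithm makes amortized at most $f(k,n)$ distance queries per operation, outputs at most $Bk$ centers, and has approximation ratio $a$. -/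

import Mathlib

open Filter Topology

namespace DynClust

/-! ### Metrics, clustering problems, optimal values

Points carry labels in `ℕ`.  `P` is the finite set of current points, `pool` the finite set of
points that may be used as centers, `d` the distance function. -/

/-- `d` is a metric on the finite set `Q`, of aspect ratio at most `Δ`. -/
structure MetricOn (Q : Finset ℕ) (Δ : ℝ) (d : ℕ → ℕ → ℝ) : Prop where
  self : ∀ x ∈ Q, d x x = 0
  pos : ∀ x ∈ Q, ∀ y ∈ Q, x ≠ y → 0 < d x y
  symm : ∀ x ∈ Q, ∀ y ∈ Q, d x y = d y x
  triangle : ∀ x ∈ Q, ∀ y ∈ Q, ∀ z ∈ Q, d x z ≤ d x y + d y z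
  aspect : ∀ x ∈ Q, ∀ y ∈ Q, ∀ u ∈ Q, ∀ v ∈ Q, x ≠ y → u ≠ v → d x y ≤ Δ * d u v

/-- The distance of `x` to its closest center in the (nonempty) set `C`. -/
noncomputable def distTo (d : ℕ → ℕ → ℝ) (C : Finset ℕ) (x : ℕ) : ℝ :=
  ⨅ c : C, d x c

/-- The diameter of a finite set. -/
noncomputable def diam (d : ℕ → ℕ → ℝ) (S : Finset ℕ) : ℝ :=
  ⨆ x : S, ⨆ y : S, d x y

/-- A clustering problem: the format of its solutions, the number of centers (clusters) of a
solution, which solutions are feasible, and what they cost. -/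
structure Problem where
  Sol : Type
  size : Sol → ℕ
  Feasible : (P pool : Finset ℕ) → (d : ℕ → ℕ → ℝ) → Sol → Prop
  cost : (P : Finset ℕ) → (d : ℕ → ℕ → ℝ) → Sol → ℝ

/-- The problems whose solutions are plain sets of centers. -/
def centerProblem (cost : Finset ℕ → (ℕ → ℕ → ℝ) → Finset ℕ → ℝ) : Problem where
  Sol := Finset ℕ
  size := Finset.card
  Feasible := fun P pool _ C => C ⊆ pool ∧ (P.Nonempty → C.Nonempty)
  cost := cost

/-- `k`-center: the largest distance of a point to its closest center. -/
noncomputable def kCenter : Problem :=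
  centerProblem fun P d C => ⨆ x : P, distTo d C x

/-- `k`-median: the sum of the distances. -/
noncomputable def kMedian : Problem :=
  centerProblem fun P d C => ∑ x ∈ P, distTo d C x

/-- `k`-means: the sum of the squared distances. -/
noncomputable def kMeans : Problem :=
  centerProblem fun P d C => ∑ x ∈ P, distTo d C x ^ 2

/-- `(k,p)`-clustering: the sum of the `p`-th powers of the distances. -/
noncomputable def kpClustering (p : ℝ) : Problem :=
  centerProblem fun P d C => ∑ x ∈ P, distTo d C x ^ p

/-- `k`-sum-of-radii: a solution is a set of pairs (center, radius) that covers all points. -/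
noncomputable def kSumRadii : Problem where
  Sol := Finset (ℕ × ℝ)
  size := Finset.card
  Feasible := fun P pool d S =>
    (∀ c ∈ S, c.1 ∈ pool ∧ 0 ≤ c.2) ∧ ∀ x ∈ P, ∃ c ∈ S, d x c.1 ≤ c.2
  cost := fun _ _ S => ∑ c ∈ S, c.2

/-- `k`-sum-of-diameters: a solution is a partition of the current points into clusters. -/
noncomputable def kSumDiameters : Problem where
  Sol := Finset (Finset ℕ)
  size := Finset.card
  Feasible := fun P _ _ S =>
    (∀ T ∈ S, T.Nonempty) ∧ (∀ T ∈ S, ∀ U ∈ S, T ≠ U → Disjoint T U) ∧ S.biUnion id = P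
  cost := fun _ d S => ∑ T ∈ S, diam d T

/-- The optimal cost over the feasible solutions with at most `k` centers. -/
noncomputable def opt (prob : Problem) (P pool : Finset ℕ) (d : ℕ → ℕ → ℝ) (k : ℕ) : ℝ :=
  sInf {r | ∃ S : prob.Sol, prob.Feasible P pool d S ∧ prob.size S ≤ k ∧ prob.cost P d S = r}

/-! ### The game between the adaptive adversary and the algorithm -/

/-- The operations of the adversary: updates, value-queries and solution-queries. -/
inductive Op where
  | ins (x : ℕ)
  | del (x : ℕ)
  | askValue
  | askSolution

/-- What happens in a play: the adversary issues an operation; the algorithm issues a distance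
query, answered by the adversary with `v`; the algorithm finishes an update, answers a
value-query, or answers a solution-query. -/
inductive Event (Sol : Type) where
  | op (o : Op)
  | dist (x y : ℕ) (v : ℝ)
  | done
  | value (v : ℝ)
  | solution (S : Sol)

/-- The transcript of a play; the most recent event is the head of the list. -/
abbrev Transcript (Sol : Type) := List (Event Sol)

variable {Sol : Type}

/-- The current points. -/
def current : Transcript Sol → Finset ℕ
  | [] => ∅
  | .op (.ins x) :: tr => insert x (current tr)
  | .op (.del x) :: tr => (current tr).erase x
  | _ :: tr => current tr

/-- All points that were ever inserted, including the deleted ones. -/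
def inserted : Transcript Sol → Finset ℕ
  | [] => ∅
  | .op (.ins x) :: tr => insert x (inserted tr)
  | _ :: tr => inserted tr

/-- The points that may serve as centers: the current points, or also the deleted ones. -/
def pool (allowDeleted : Bool) (tr : Transcript Sol) : Finset ℕ :=
  if allowDeleted then inserted tr else current tr

/-- The number of distance queries so far. -/
def numQueries : Transcript Sol → ℕ
  | [] => 0
  | .dist _ _ _ :: tr => numQueries tr + 1
  | _ :: tr => numQueries tr

/-- The sum of `F n` over all operations so far, `n` being the number of points at the beginning
of the respective operation. -/
def budget (F : ℕ → ℝ) : Transcript Sol → ℝ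
  | [] => 0
  | .op _ :: tr => budget F tr + F (current tr).card
  | _ :: tr => budget F tr

/-- The operation that the algorithm is processing, if any. -/
def pending : Transcript Sol → Option Op
  | .op o :: _ => some o
  | .dist _ _ _ :: tr => pending tr
  | _ => none

/-- The updates are legal: inserted points are new, deleted points are present. -/
def WellFormed : Transcript Sol → Prop
  | [] => True
  | .op (.ins x) :: tr => x ∉ inserted tr ∧ WellFormed tr
  | .op (.del x) :: tr => x ∈ current tr ∧ WellFormed tr
  | _ :: tr => WellFormed tr

/-- A metric, of aspect ratio at most `Δ`, on all points inserted so far that agrees with all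
reported distances, so that it may be the true one. -/
def Consistent (Δ : ℝ) (tr : Transcript Sol) (d : ℕ → ℕ → ℝ) : Prop :=
  MetricOn (inserted tr) Δ d ∧ ∀ x y v, Event.dist x y v ∈ tr → d x y = v

/-- A dynamic algorithm.  After each event it decides, from all it has seen so far, whether to
query a further distance or to finish the pending operation, and what it answers.
Distances may be queried between any two points inserted so far, deleted or not. -/
structure Algorithm (Sol : Type) where
  next : Transcript Sol → Option (ℕ × ℕ)
  value : Transcript Sol → ℝ
  solution : Transcript Sol → Sol
  next_mem : ∀ tr q, next tr = some q → q.1 ∈ inserted tr ∧ q.2 ∈ inserted tr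

/-- A strategy of an adaptive adversary: the next operation and the answers to distance queries
depend on all that has happened so far, and on nothing else. -/
structure Adversary (Sol : Type) where
  nextOp : Transcript Sol → Op
  answer : Transcript Sol → ℕ → ℕ → ℝ

/-- One step of the play. -/
def step (A : Adversary Sol) (alg : Algorithm Sol) (tr : Transcript Sol) : Transcript Sol :=
  match pending tr with
  | none => .op (A.nextOp tr) :: tr
  | some o =>
    match alg.next tr with
    | some q => .dist q.1 q.2 (A.answer tr q.1 q.2) :: tr
    | none =>
      match o with
      | .askValue => .value (alg.value tr) :: tr
      | .askSolution => .solution (alg.solution tr) :: tr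
      | .ins _ => .done :: tr
      | .del _ => .done :: tr

/-- The transcript after `s` steps. -/
def run (A : Adversary Sol) (alg : Algorithm Sol) (s : ℕ) : Transcript Sol :=
  (step A alg)^[s] []

/-- Whatever the algorithm does, the adversary issues only legal updates and its answers stem from
a metric of aspect ratio at most `Δ`. -/
def Adversary.Legal (A : Adversary Sol) (Δ : ℝ) : Prop :=
  ∀ (alg : Algorithm Sol) (s : ℕ),
    WellFormed (run A alg s) ∧ ∃ d, Consistent Δ (run A alg s) d

/-- Against `A`, the algorithm makes amortized at most `F n` distance queries per operation. -/
def AmortizedQueries (A : Adversary Sol) (alg : Algorithm Sol) (F : ℕ → ℝ) : Prop :=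
  ∀ s, (numQueries (run A alg s) : ℝ) ≤ budget F (run A alg s)

/-- All answers `v` to value-queries satisfy `OPT ≤ v ≤ α n * OPT`, whichever consistent metric is
the true one; `n` is the number of current points. -/
def ValueRatio (prob : Problem) (allowDeleted : Bool) (k : ℕ) (Δ : ℝ)
    (A : Adversary prob.Sol) (alg : Algorithm prob.Sol) (α : ℕ → ℝ) : Prop :=
  ∀ s v tr, run A alg s = .value v :: tr → ∀ d, Consistent Δ tr d →
    opt prob (current tr) (pool allowDeleted tr) d k ≤ v ∧
    v ≤ α (current tr).card * opt prob (current tr) (pool allowDeleted tr) d k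

/-- All answers to solution-queries are feasible, have at most `g` centers, and cost at most
`α n * OPT`, where `OPT` is the optimal cost with `k` centers, whichever consistent metric is the
true one; `n` is the number of current points. -/
def SolutionRatio (prob : Problem) (allowDeleted : Bool) (k g : ℕ) (Δ : ℝ)
    (A : Adversary prob.Sol) (alg : Algorithm prob.Sol) (α : ℕ → ℝ) : Prop :=
  ∀ s S tr, run A alg s = .solution S :: tr → ∀ d, Consistent Δ tr d →
    prob.Feasible (current tr) (pool allowDeleted tr) d S ∧ prob.size S ≤ g ∧
    prob.cost (current tr) d S ≤
      α (current tr).card * opt prob (current tr) (pool allowDeleted tr) d k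

/-- There is a legal strategy of the adversary such that each algorithm that makes amortized at
most `F n` distance queries per operation and uses at most `g` centers has an approximation ratio
of at least `bound n`, for some number `n` of current points between `m` and `4 * m`. -/
def ForcesRatio (prob : Problem) (allowDeleted : Bool) (k g : ℕ) (F : ℕ → ℝ) (Δ : ℝ) (m : ℕ)
    (bound : ℕ → ℝ) : Prop :=
  ∃ A : Adversary prob.Sol, A.Legal Δ ∧ ∀ (alg : Algorithm prob.Sol) (α : ℕ → ℝ),
    AmortizedQueries A alg F → ValueRatio prob allowDeleted k Δ A alg α →
    SolutionRatio prob allowDeleted k g Δ A alg α →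
    ∃ n, m ≤ n ∧ n ≤ 4 * m ∧ bound n ≤ α n

/-- The same if the algorithm has to answer solution-queries only: nothing is required of its
answers to value-queries. -/
def ForcesSolutionRatio (prob : Problem) (allowDeleted : Bool) (k g : ℕ) (F : ℕ → ℝ) (Δ : ℝ)
    (m : ℕ) (bound : ℕ → ℝ) : Prop :=
  ∃ A : Adversary prob.Sol, A.Legal Δ ∧ ∀ (alg : Algorithm prob.Sol) (α : ℕ → ℝ),
    AmortizedQueries A alg F → SolutionRatio prob allowDeleted k g Δ A alg α →
    ∃ n, m ≤ n ∧ n ≤ 4 * m ∧ bound n ≤ α n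

/-- For some aspect ratio bound, some legal strategy of the adversary defeats all algorithms that
make amortized at most `F n` distance queries per operation, use at most `g` centers, and claim
the constant approximation ratio `a`. -/
def Unattainable (prob : Problem) (allowDeleted : Bool) (k g : ℕ) (F : ℕ → ℝ) (a : ℝ) : Prop :=
  ∃ (Δ : ℝ) (A : Adversary prob.Sol), A.Legal Δ ∧ ∀ alg : Algorithm prob.Sol,
    ¬ (AmortizedQueries A alg F ∧ ValueRatio prob allowDeleted k Δ A alg (fun _ => a) ∧
      SolutionRatio prob allowDeleted k g Δ A alg (fun _ => a))

end DynClust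

namespace DynClust

/-! ### Truncated graph distances -/

/-! The adversary inserts `2 * m` points and keeps the metric undecided between two graphs. The
sparse graph has the edges `E` committed so far; the dense graph also joins all open points, those
of degree below a threshold `t`. All metrics are graph distances truncated at `L`. A query is
answered by the dense distance, the smallest still possible. A shortest dense path needs at most one
uncommitted edge (`exists_shortcut`), so committing one edge makes the sparse distance agree
(`capDist_fixDist_le`). From then on the sparse graph only grows and the dense one only shrinks, so
every graph between them realizes all answers (`PlayInv.consistent`).

Points that are no longer open get deleted. Each of them has absorbed at least `t` edge ends, while
a query creates at most two. With at most `t / 8` queries per operation deletions are therefore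
rare, and at some moment the algorithm answers while at least `m` points are present, all of them
open (`exists_aboutToAnswer`).

At that moment two scenarios remain possible. In the dense metric all current points are within
distance 1 of one another. In the sparse metric degrees are bounded, so balls of radius `r` hold at
most `(16 * a) ^ r` points (`card_le_of_near`, with `t = 8 * a`), and few centers leave some point
at distance `r + 1`. A value must fit both scenarios, which gives the ratio `r + 1`. A solution `C`
is refuted by an intermediate metric: joining only the points far from `C` makes them mutually close
but keeps them far from `C` (`le_capDist_sup_cliqueOn`), so `C` pays about `(r + 1) ^ p` per point
and a better center pays `O(1)`.

With `a` the query bound at `2 * m`, the largest possible `r` is of order `log m / log (16 * a)`,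
which is the claimed bound. If the query bound is `n ^ o(1)`, this tends to infinity. -/

/-- The distance of `x` and `y` in the graph `G`, truncated at `L`. -/
noncomputable def capDist (G : SimpleGraph ℕ) (L x y : ℕ) : ℕ :=
  sInf {n | n = L ∨ ∃ w : G.Walk x y, w.length = n}

/-- The set in the definition always contains `L`, so unconnected points need no convention for an
infimum over the empty set. The metric properties below are read off from this characterization. -/
theorem capDist_le_iff {G : SimpleGraph ℕ} {L x y n : ℕ} :
    capDist G L x y ≤ n ↔ L ≤ n ∨ ∃ w : G.Walk x y, w.length ≤ n := by
  constructor
  · intro h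
    have hmem : capDist G L x y ∈ {n | n = L ∨ ∃ w : G.Walk x y, w.length = n} :=
      Nat.sInf_mem ⟨L, Or.inl rfl⟩
    rcases hmem with h1 | ⟨w, hw⟩
    · exact Or.inl (h1 ▸ h)
    · exact Or.inr ⟨w, hw ▸ h⟩
  · rintro (h | ⟨w, hw⟩)
    · exact (Nat.sInf_le (Or.inl rfl)).trans h
    · exact (Nat.sInf_le (Or.inr ⟨w, rfl⟩)).trans hw

theorem capDist_le {G : SimpleGraph ℕ} {L x y : ℕ} : capDist G L x y ≤ L :=
  capDist_le_iff.2 (Or.inl le_rfl)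

theorem capDist_anti {G H : SimpleGraph ℕ} (h : G ≤ H) (L x y : ℕ) :
    capDist H L x y ≤ capDist G L x y := by
  rcases capDist_le_iff.1 (le_refl (capDist G L x y)) with h1 | ⟨w, hw⟩
  · exact capDist_le_iff.2 (Or.inl h1)
  · exact capDist_le_iff.2 (Or.inr ⟨w.mapLe h, by simpa using hw⟩)

theorem capDist_le_one {G : SimpleGraph ℕ} {L x y : ℕ} (h : x ≠ y → G.Adj x y) :
    capDist G L x y ≤ 1 := by
  by_cases hxy : x = y
  · subst hxy
    exact capDist_le_iff.2 (Or.inr ⟨.nil, by simp⟩)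
  · exact capDist_le_iff.2 (Or.inr ⟨(h hxy).toWalk, by simp⟩)

theorem capDist_symm_le (G : SimpleGraph ℕ) (L x y : ℕ) :
    capDist G L x y ≤ capDist G L y x := by
  rcases capDist_le_iff.1 (le_refl (capDist G L y x)) with h1 | ⟨w, hw⟩
  · exact capDist_le_iff.2 (Or.inl h1)
  · exact capDist_le_iff.2 (Or.inr ⟨w.reverse, by simpa using hw⟩)

theorem capDist_symm (G : SimpleGraph ℕ) (L x y : ℕ) : capDist G L x y = capDist G L y x :=
  le_antisymm (capDist_symm_le G L x y) (capDist_symm_le G L y x)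

theorem capDist_triangle (G : SimpleGraph ℕ) (L x y z : ℕ) :
    capDist G L x z ≤ capDist G L x y + capDist G L y z := by
  rcases capDist_le_iff.1 (le_refl (capDist G L x y)) with h1 | ⟨w, hw⟩
  · exact capDist_le_iff.2 (Or.inl (by omega))
  rcases capDist_le_iff.1 (le_refl (capDist G L y z)) with h1 | ⟨w', hw'⟩
  · exact capDist_le_iff.2 (Or.inl (by omega))
  exact capDist_le_iff.2 (Or.inr ⟨w.append w', by rw [SimpleGraph.Walk.length_append]; omega⟩)

theorem capDist_pos {G : SimpleGraph ℕ} {L x y : ℕ} (hL : 1 ≤ L) (h : x ≠ y) :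
    1 ≤ capDist G L x y := by
  by_contra hlt
  rcases capDist_le_iff.1 (show capDist G L x y ≤ 0 by omega) with h1 | ⟨w, hw⟩
  · omega
  · exact h (SimpleGraph.Walk.eq_of_length_eq_zero (p := w) (by omega))

/-- Distances of distinct points lie between 1 and `L`, so the truncation is what bounds the aspect
ratio. -/
theorem metricOn_capDist (Q : Finset ℕ) (G : SimpleGraph ℕ) {L : ℕ} {Δ : ℝ} (hL : 1 ≤ L)
    (hΔ : (L : ℝ) ≤ Δ) : MetricOn Q Δ fun x y => (capDist G L x y : ℝ) where
  self x _ := by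
    have : capDist G L x x ≤ 0 := capDist_le_iff.2 (Or.inr ⟨.nil, by simp⟩)
    simpa using this
  pos x _ y _ h := by exact_mod_cast capDist_pos hL h
  symm x _ y _ := by rw [capDist_symm]
  triangle x _ y _ z _ := by exact_mod_cast capDist_triangle G L x y z
  aspect x _ y _ u _ v _ _ h := by
    have h1 : (capDist G L x y : ℝ) ≤ L := by exact_mod_cast capDist_le
    have h2 : (1 : ℝ) ≤ capDist G L u v := by exact_mod_cast capDist_pos hL h
    have h3 : (1 : ℝ) ≤ L := by exact_mod_cast hL
    nlinarith

/-! ### Finite edge sets -/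

/-- The graph with edge set `E`. -/
def edgeGraph (E : Finset (ℕ × ℕ)) : SimpleGraph ℕ where
  Adj x y := x ≠ y ∧ ((x, y) ∈ E ∨ (y, x) ∈ E)
  symm := ⟨fun _ _ h => ⟨h.1.symm, h.2.symm⟩⟩
  loopless := ⟨fun _ h => h.1 rfl⟩

/-- The number of edges of `E` at `v`. -/
def edgeDeg (E : Finset (ℕ × ℕ)) (v : ℕ) : ℕ :=
  (E.filter fun e => e.1 = v).card + (E.filter fun e => e.2 = v).card

/-- The complete graph on the set `S`. -/
def cliqueOn (S : Set ℕ) : SimpleGraph ℕ where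
  Adj x y := x ≠ y ∧ x ∈ S ∧ y ∈ S
  symm := ⟨fun _ _ h => ⟨h.1.symm, h.2.2, h.2.1⟩⟩
  loopless := ⟨fun _ h => h.1 rfl⟩

/-- The points of degree less than `t`. -/
def openSet (t : ℝ) (E : Finset (ℕ × ℕ)) : Set ℕ := {v | (edgeDeg E v : ℝ) < t}

/-- The graph with all edges that may still turn out to be present. -/
def denseGraph (t : ℝ) (E : Finset (ℕ × ℕ)) : SimpleGraph ℕ :=
  edgeGraph E ⊔ cliqueOn (openSet t E)

theorem cliqueOn_mono {S T : Set ℕ} (h : S ⊆ T) : cliqueOn S ≤ cliqueOn T :=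
  fun _ _ hxy => ⟨hxy.1, h hxy.2.1, h hxy.2.2⟩

theorem edgeGraph_mono {E E' : Finset (ℕ × ℕ)} (h : E ⊆ E') : edgeGraph E ≤ edgeGraph E' :=
  fun _ _ hxy => ⟨hxy.1, hxy.2.imp (@h _) (@h _)⟩

theorem edgeDeg_mono {E E' : Finset (ℕ × ℕ)} (h : E ⊆ E') (v : ℕ) :
    edgeDeg E v ≤ edgeDeg E' v :=
  add_le_add (Finset.card_le_card (Finset.filter_subset_filter _ h))
    (Finset.card_le_card (Finset.filter_subset_filter _ h))

theorem openSet_anti {t : ℝ} {E E' : Finset (ℕ × ℕ)} (h : E ⊆ E') :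
    openSet t E' ⊆ openSet t E := fun v hv =>
  lt_of_le_of_lt (by exact_mod_cast edgeDeg_mono h v) (show (edgeDeg E' v : ℝ) < t from hv)

theorem sum_edgeDeg_le (E : Finset (ℕ × ℕ)) (T : Finset ℕ) :
    ∑ v ∈ T, edgeDeg E v ≤ 2 * E.card := by
  have h (g : ℕ × ℕ → ℕ) : ∑ v ∈ T, (E.filter fun e => g e = v).card ≤ E.card := by
    rw [← Finset.card_biUnion]
    · exact Finset.card_le_card (Finset.biUnion_subset.2 fun v _ => Finset.filter_subset _ _)
    · intro u _ v _ huv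
      refine Finset.disjoint_left.2 fun e he he' => huv ?_
      rw [← (Finset.mem_filter.1 he).2, (Finset.mem_filter.1 he').2]
  have h1 := h Prod.fst
  have h2 := h Prod.snd
  unfold edgeDeg
  rw [Finset.sum_add_distrib]
  omega

/-- As the ends of `e` differ, at most one of the two filters grows at any given vertex. -/
theorem edgeDeg_insert_le {E : Finset (ℕ × ℕ)} {e : ℕ × ℕ} (he : e.1 ≠ e.2) (v : ℕ) :
    edgeDeg (insert e E) v ≤ edgeDeg E v + if v = e.1 ∨ v = e.2 then 1 else 0 := by
  unfold edgeDeg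
  rw [Finset.filter_insert, Finset.filter_insert]
  have h1 := Finset.card_insert_le e (E.filter fun e => e.1 = v)
  have h2 := Finset.card_insert_le e (E.filter fun e => e.2 = v)
  split_ifs <;> omega

/-! ### Balls in graphs of bounded degree -/

/-- The vertices that can be reached from `c` with at most `r` edges. -/
def reachSet (E : Finset (ℕ × ℕ)) (c : ℕ) : ℕ → Finset ℕ
  | 0 => {c}
  | r + 1 => (reachSet E c r).biUnion fun z =>
      insert z ((E.filter fun e => e.1 = z).image Prod.snd ∪
        (E.filter fun e => e.2 = z).image Prod.fst)

theorem self_mem_reachSet (E : Finset (ℕ × ℕ)) (c r : ℕ) : c ∈ reachSet E c r := by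
  induction r with
  | zero => simp [reachSet]
  | succ r ih => exact Finset.mem_biUnion.2 ⟨c, ih, Finset.mem_insert_self _ _⟩

theorem mem_reachSet {E : Finset (ℕ × ℕ)} {c x r : ℕ} (w : (edgeGraph E).Walk x c)
    (hw : w.length ≤ r) : x ∈ reachSet E c r := by
  induction w generalizing r with
  | nil => exact self_mem_reachSet E _ r
  | @cons x z c hadj w ih =>
    obtain ⟨r, rfl⟩ : ∃ s, r = s + 1 :=
      ⟨r - 1, by rw [SimpleGraph.Walk.length_cons] at hw; omega⟩
    rw [SimpleGraph.Walk.length_cons] at hw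
    refine Finset.mem_biUnion.2 ⟨z, ih (by omega), Finset.mem_insert_of_mem ?_⟩
    rcases hadj.2 with h | h
    · exact Finset.mem_union_right _ (Finset.mem_image.2 ⟨(x, z), by simp [h], rfl⟩)
    · exact Finset.mem_union_left _ (Finset.mem_image.2 ⟨(z, x), by simp [h], rfl⟩)

/-- One more step replaces each vertex by itself and its neighbours, hence the `+ 1` in the
hypothesis and the factor `K`. -/
theorem card_reachSet_le {E : Finset (ℕ × ℕ)} {K : ℝ} (hK : ∀ v, (edgeDeg E v : ℝ) + 1 ≤ K)
    (c r : ℕ) : ((reachSet E c r).card : ℝ) ≤ K ^ r := by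
  induction r with
  | zero => simp [reachSet]
  | succ r ih =>
    have hK0 : 0 ≤ K := le_trans (by positivity) (hK 0)
    have h1 : (reachSet E c (r + 1)).card ≤ ∑ z ∈ reachSet E c r, (edgeDeg E z + 1) := by
      refine Finset.card_biUnion_le.trans (Finset.sum_le_sum fun z _ => ?_)
      refine (Finset.card_insert_le _ _).trans (Nat.succ_le_succ ?_)
      exact (Finset.card_union_le _ _).trans
        (add_le_add Finset.card_image_le Finset.card_image_le)
    calc ((reachSet E c (r + 1)).card : ℝ)
        ≤ ∑ z ∈ reachSet E c r, ((edgeDeg E z : ℝ) + 1) := by exact_mod_cast h1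
      _ ≤ ∑ z ∈ reachSet E c r, K := Finset.sum_le_sum fun z _ => hK z
      _ = (reachSet E c r).card * K := by simp
      _ ≤ K ^ r * K := by gcongr
      _ = K ^ (r + 1) := (pow_succ _ _).symm

/-- In a graph of bounded degree, few points are close to one of a few centers. -/
theorem card_le_of_near {E : Finset (ℕ × ℕ)} {K : ℝ} (hK : ∀ v, (edgeDeg E v : ℝ) + 1 ≤ K)
    {P C : Finset ℕ} {r : ℕ} (h : ∀ x ∈ P, ∃ c ∈ C, capDist (edgeGraph E) (r + 1) x c ≤ r) :
    (P.card : ℝ) ≤ C.card * K ^ r := by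
  have hsub : P ⊆ C.biUnion fun c => reachSet E c r := by
    intro x hx
    obtain ⟨c, hc, hxc⟩ := h x hx
    -- The truncation level `r + 1` exceeds `r`, so the distance comes from an actual walk.
    rcases capDist_le_iff.1 hxc with h1 | ⟨w, hw⟩
    · omega
    · exact Finset.mem_biUnion.2 ⟨c, hc, mem_reachSet w hw⟩
  calc (P.card : ℝ) ≤ ∑ c ∈ C, ((reachSet E c r).card : ℝ) := by
        exact_mod_cast (Finset.card_le_card hsub).trans Finset.card_biUnion_le
    _ ≤ ∑ c ∈ C, K ^ r := Finset.sum_le_sum fun c _ => card_reachSet_le hK c r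
    _ = C.card * K ^ r := by simp

/-! ### Shortcuts through a clique -/

/-- A walk in a graph to which a clique was added can be replaced by one that uses at most one
edge of the clique. -/
theorem exists_shortcut {G : SimpleGraph ℕ} {S : Set ℕ} {x y : ℕ} (w : (G ⊔ cliqueOn S).Walk x y) :
    (∃ q : G.Walk x y, q.length ≤ w.length) ∨
      ∃ u ∈ S, ∃ v ∈ S, ∃ (q : G.Walk x u) (q' : G.Walk v y), q.length + 1 + q'.length ≤ w.length := by
  induction w with
  | nil => exact Or.inl ⟨.nil, le_rfl⟩
  | cons hadj w ih =>
    rw [SimpleGraph.Walk.length_cons]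
    rcases hadj with hadj | hadj
    · rcases ih with ⟨q, hq⟩ | ⟨u, hu, v, hv, q, q', hq⟩
      · exact Or.inl ⟨.cons hadj q, by rw [SimpleGraph.Walk.length_cons]; omega⟩
      · exact Or.inr ⟨u, hu, v, hv, .cons hadj q, q', by
          rw [SimpleGraph.Walk.length_cons]; omega⟩
    · rcases ih with ⟨q, hq⟩ | ⟨u, hu, v, hv, q, q', hq⟩
      · exact Or.inr ⟨_, hadj.2.1, _, hadj.2.2, .nil, q, by
          rw [SimpleGraph.Walk.length_nil]; omega⟩
      · exact Or.inr ⟨_, hadj.2.1, v, hv, .nil, q', by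
          rw [SimpleGraph.Walk.length_nil]; omega⟩

/-- Adding a clique on points that are far from `c` does not bring them closer to `c`. -/
theorem le_capDist_sup_cliqueOn {G : SimpleGraph ℕ} {S : Set ℕ} {L x c : ℕ} (hx : x ∈ S)
    (hS : ∀ z ∈ S, L ≤ capDist G L z c) : L ≤ capDist (G ⊔ cliqueOn S) L x c := by
  rcases capDist_le_iff.1 (le_refl (capDist (G ⊔ cliqueOn S) L x c)) with h | ⟨w, hw⟩
  · exact h
  refine le_trans ?_ hw
  rcases exists_shortcut w with ⟨q, hq⟩ | ⟨u, hu, v, hv, q, q', hq⟩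
  · exact (hS x hx).trans ((capDist_le_iff.2 (Or.inr ⟨q, le_rfl⟩)).trans hq)
  -- The tail behind the clique edge starts in `S` and alone has length at least `L`.
  · exact (hS v hv).trans ((capDist_le_iff.2 (Or.inr ⟨q', le_rfl⟩)).trans (by omega))

/-! ### Fixing the answer to a distance query -/

open Classical in
/-- The edge set after a query of the distance of `x` and `y`: it determines this distance. -/
noncomputable def fixDist (t : ℝ) (L : ℕ) (E : Finset (ℕ × ℕ)) (x y : ℕ) : Finset (ℕ × ℕ) :=
  if h : ∃ e : ℕ × ℕ, e.1 ≠ e.2 ∧ e.1 ∈ openSet t E ∧ e.2 ∈ openSet t E ∧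
      capDist (edgeGraph (insert e E)) L x y ≤ capDist (denseGraph t E) L x y
  then insert h.choose E else E

theorem fixDist_spec (t : ℝ) (L : ℕ) (E : Finset (ℕ × ℕ)) (x y : ℕ) :
    fixDist t L E x y = E ∨ ∃ e : ℕ × ℕ, e.1 ≠ e.2 ∧ e.1 ∈ openSet t E ∧ e.2 ∈ openSet t E ∧
      fixDist t L E x y = insert e E := by
  unfold fixDist
  split_ifs with h
  · exact Or.inr ⟨h.choose, h.choose_spec.1, h.choose_spec.2.1, h.choose_spec.2.2.1, rfl⟩
  · exact Or.inl rfl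

theorem capDist_fixDist_le (t : ℝ) (L : ℕ) (E : Finset (ℕ × ℕ)) (x y : ℕ) :
    capDist (edgeGraph (fixDist t L E x y)) L x y ≤ capDist (denseGraph t E) L x y := by
  unfold fixDist
  split_ifs with h
  · exact h.choose_spec.2.2.2
  rcases capDist_le_iff.1 (le_refl (capDist (denseGraph t E) L x y)) with h1 | ⟨w, hw⟩
  · exact capDist_le.trans h1
  rcases exists_shortcut w with ⟨q, hq⟩ | ⟨u, hu, v, hv, q, q', hq⟩
  · exact capDist_le_iff.2 (Or.inr ⟨q, hq.trans hw⟩)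
  replace hq := hq.trans hw
  by_cases huv : u = v
  · subst huv
    exact capDist_le_iff.2 (Or.inr ⟨q.append q', by
      rw [SimpleGraph.Walk.length_append]; omega⟩)
  -- A shortest dense walk with one clique edge shows that this edge was an admissible choice for
  -- `fixDist`.
  refine absurd ⟨(u, v), huv, hu, hv, capDist_le_iff.2 (Or.inr ?_)⟩ h
  have hle := edgeGraph_mono (Finset.subset_insert (u, v) E)
  have hadj : (edgeGraph (insert (u, v) E)).Adj u v := ⟨huv, Or.inl (Finset.mem_insert_self _ _)⟩
  refine ⟨(q.mapLe hle).append (.cons hadj (q'.mapLe hle)), ?_⟩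
  rw [SimpleGraph.Walk.length_append, SimpleGraph.Walk.length_cons]
  simp only [SimpleGraph.Walk.length_map, SimpleGraph.Walk.mapLe]
  omega

theorem subset_fixDist (t : ℝ) (L : ℕ) (E : Finset (ℕ × ℕ)) (x y : ℕ) :
    E ⊆ fixDist t L E x y := by
  rcases fixDist_spec t L E x y with h | ⟨e, -, -, -, h⟩ <;> rw [h]
  exact Finset.subset_insert _ _

/-- The new edge joins two open points, so the clique contained it already, and the open set can
only shrink. Hence dense distances never fall below earlier answers. -/
theorem denseGraph_fixDist_le (t : ℝ) (L : ℕ) (E : Finset (ℕ × ℕ)) (x y : ℕ) :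
    denseGraph t (fixDist t L E x y) ≤ denseGraph t E := by
  refine sup_le ?_ ((cliqueOn_mono (openSet_anti (subset_fixDist t L E x y))).trans le_sup_right)
  rcases fixDist_spec t L E x y with h | ⟨e, he, h1, h2, h⟩ <;> rw [h]
  · exact le_sup_left
  intro u v huv
  rcases huv.2 with h3 | h3 <;> rcases Finset.mem_insert.1 h3 with h4 | h4
  · exact Or.inr ⟨huv.1, by rw [← h4] at h1; exact h1, by rw [← h4] at h2; exact h2⟩
  · exact Or.inl ⟨huv.1, Or.inl h4⟩
  · exact Or.inr ⟨huv.1, by rw [← h4] at h2; exact h2, by rw [← h4] at h1; exact h1⟩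
  · exact Or.inl ⟨huv.1, Or.inr h4⟩

theorem card_fixDist_le (t : ℝ) (L : ℕ) (E : Finset (ℕ × ℕ)) (x y : ℕ) :
    (fixDist t L E x y).card ≤ E.card + 1 := by
  rcases fixDist_spec t L E x y with h | ⟨e, -, -, -, h⟩ <;> rw [h]
  · omega
  · exact Finset.card_insert_le _ _

/-- Edges are added only at open points; the bound is `t + 1` because the last edge may lift a
degree from just below `t`. -/
theorem edgeDeg_fixDist_lt {t : ℝ} {L : ℕ} {E : Finset (ℕ × ℕ)}
    (hE : ∀ v, (edgeDeg E v : ℝ) < t + 1) (x y v : ℕ) :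
    (edgeDeg (fixDist t L E x y) v : ℝ) < t + 1 := by
  rcases fixDist_spec t L E x y with h | ⟨e, he, h1, h2, h⟩ <;> rw [h]
  · exact hE v
  have h3 := edgeDeg_insert_le (E := E) he v
  split_ifs at h3 with hv
  · have h4 : (edgeDeg E v : ℝ) < t := by rcases hv with rfl | rfl <;> assumption
    have h5 : (edgeDeg (insert e E) v : ℝ) ≤ edgeDeg E v + 1 := by exact_mod_cast h3
    linarith
  · exact lt_of_le_of_lt (by exact_mod_cast h3) (hE v)

end DynClust

namespace DynClust

/-! ### The strategy of the adversary -/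

variable {Sol : Type}

/-- The edges determined by the distance queries of a play. -/
noncomputable def edgesOf (t : ℝ) (L : ℕ) : Transcript Sol → Finset (ℕ × ℕ)
  | [] => ∅
  | .dist x y _ :: tr => fixDist t L (edgesOf t L tr) x y
  | _ :: tr => edgesOf t L tr

open Classical in
/-- Insert `M` points; from then on, delete a current point that is not open any more, and issue
the query `q` if there is none. -/
noncomputable def graphAdversary (Sol : Type) (t : ℝ) (L M : ℕ) (q : Op) : Adversary Sol where
  nextOp tr :=
    if (inserted tr).card < M then .ins (inserted tr).card
    else if h : ∃ x ∈ current tr, x ∉ openSet t (edgesOf t L tr) then .del h.choose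
    else q
  answer tr x y := capDist (denseGraph t (edgesOf t L tr)) L x y

/-- The query operations. -/
def IsAsk (q : Op) : Prop := q = .askValue ∨ q = .askSolution

theorem nextOp_cases (Sol : Type) (t : ℝ) (L M : ℕ) (q : Op) (tr : Transcript Sol) :
    ((inserted tr).card < M ∧
      (graphAdversary Sol t L M q).nextOp tr = .ins (inserted tr).card) ∨
    (M ≤ (inserted tr).card ∧ ∃ x ∈ current tr, x ∉ openSet t (edgesOf t L tr) ∧
      (graphAdversary Sol t L M q).nextOp tr = .del x) ∨
    (M ≤ (inserted tr).card ∧ (∀ x ∈ current tr, x ∈ openSet t (edgesOf t L tr)) ∧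
      (graphAdversary Sol t L M q).nextOp tr = q) := by
  unfold graphAdversary
  by_cases h1 : (inserted tr).card < M
  · simp [h1]
  by_cases h2 : ∃ x ∈ current tr, x ∉ openSet t (edgesOf t L tr)
  · refine Or.inr (Or.inl ⟨not_lt.1 h1, h2.choose, h2.choose_spec.1, h2.choose_spec.2, ?_⟩)
    simp only [h1, if_false, h2, dif_pos]
  · refine Or.inr (Or.inr ⟨not_lt.1 h1, fun x hx => not_not.1 fun h => h2 ⟨x, hx, h⟩, ?_⟩)
    simp only [h1, if_false, h2, dif_neg, not_false_eq_true]

/-- The events that finish an operation. -/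
def Finishes (o : Op) (e : Event Sol) : Prop :=
  (¬ IsAsk o ∧ e = .done) ∨ (o = .askValue ∧ ∃ v, e = .value v) ∨
    (o = .askSolution ∧ ∃ S, e = .solution S)

theorem step_cases (A : Adversary Sol) (alg : Algorithm Sol) (tr : Transcript Sol) :
    (pending tr = none ∧ step A alg tr = .op (A.nextOp tr) :: tr) ∨
    (∃ o x y, pending tr = some o ∧ step A alg tr = .dist x y (A.answer tr x y) :: tr) ∨
    (∃ o e, pending tr = some o ∧ Finishes o e ∧ step A alg tr = e :: tr) := by
  unfold step
  cases hp : pending tr with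
  | none => simp
  | some o =>
    cases hn : alg.next tr with
    | some q => simp
    | none => cases o <;> simp [Finishes, IsAsk]

theorem run_zero (A : Adversary Sol) (alg : Algorithm Sol) : run A alg 0 = [] := rfl

theorem run_succ (A : Adversary Sol) (alg : Algorithm Sol) (s : ℕ) :
    run A alg (s + 1) = step A alg (run A alg s) :=
  Function.iterate_succ_apply' _ _ _

/-! ### Invariants of a play -/

/-- What holds throughout every play. -/
structure PlayInv (t : ℝ) (L M : ℕ) (tr : Transcript Sol) : Prop where
  range : inserted tr = Finset.range (inserted tr).card
  wf : WellFormed tr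
  sub : current tr ⊆ inserted tr
  card_le : (inserted tr).card ≤ M
  deleted : ∀ x ∈ inserted tr, x ∉ current tr → x ∉ openSet t (edgesOf t L tr)
  deg : ∀ v, (edgeDeg (edgesOf t L tr) v : ℝ) < t + 1
  edges : (edgesOf t L tr).card ≤ numQueries tr
  answers : ∀ x y v, Event.dist x y v ∈ tr →
    (capDist (edgeGraph (edgesOf t L tr)) L x y : ℝ) ≤ v ∧
      v ≤ capDist (denseGraph t (edgesOf t L tr)) L x y

theorem PlayInv.nil {t : ℝ} (ht : 0 ≤ t) (L M : ℕ) : PlayInv t L M ([] : Transcript Sol) where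
  range := by simp [inserted]
  wf := trivial
  sub := by simp [current]
  card_le := by simp [inserted]
  deleted := by simp [inserted]
  deg v := by simp only [edgesOf, edgeDeg]; simp; linarith
  edges := by simp [edgesOf]
  answers := by simp

theorem PlayInv.op {t : ℝ} {L M : ℕ} {q : Op} (hq : IsAsk q) {tr : Transcript Sol}
    (h : PlayInv t L M tr) :
    PlayInv t L M (.op ((graphAdversary Sol t L M q).nextOp tr) :: tr) := by
  have hans (o : Op) : ∀ x y v, Event.dist x y v ∈ Event.op o :: tr →
      (capDist (edgeGraph (edgesOf t L tr)) L x y : ℝ) ≤ v ∧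
      v ≤ capDist (denseGraph t (edgesOf t L tr)) L x y := fun x y v hv =>
    h.answers x y v (by simpa using hv)
  rcases nextOp_cases Sol t L M q tr with ⟨h1, h2⟩ | ⟨h1, x, hx, hxo, h2⟩ | ⟨h1, -, h2⟩ <;> rw [h2]
  · have hnot : (inserted tr).card ∉ inserted tr := by
      rw [h.range]; simp
    have hcard : (insert (inserted tr).card (inserted tr)).card = (inserted tr).card + 1 :=
      Finset.card_insert_of_notMem hnot
    refine ⟨?_, ⟨hnot, h.wf⟩, Finset.insert_subset_insert _ h.sub, ?_, ?_, h.deg, h.edges, hans _⟩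
    · change insert (inserted tr).card (inserted tr) = 
      Finset.range (insert (inserted tr).card (inserted tr)).card
      rw [hcard, Finset.range_add_one, ← h.range]
    · change (insert (inserted tr).card (inserted tr)).card ≤ M
      omega
    · intro y hy hyc
      have h3 : y ∉ insert (inserted tr).card (current tr) := hyc
      rw [Finset.mem_insert, not_or] at h3
      exact h.deleted y (Finset.mem_of_mem_insert_of_ne hy h3.1) h3.2
  · refine ⟨h.range, ⟨hx, h.wf⟩, (Finset.erase_subset _ _).trans h.sub, h.card_le, ?_, h.deg,
      h.edges, hans _⟩
    intro y hy hyc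
    by_cases hyx : y = x
    · rw [hyx]; exact hxo
    · exact h.deleted y hy fun hc => hyc (Finset.mem_erase.2 ⟨hyx, hc⟩)
  · rcases hq with rfl | rfl <;>
      exact ⟨h.range, h.wf, h.sub, h.card_le, h.deleted, h.deg, h.edges, hans _⟩

/-- The two bounds on old answers persist because the sparse graph grows and the dense one shrinks.
The new answer is the old dense distance, which the new sparse graph attains. -/
theorem PlayInv.dist {t : ℝ} {L M : ℕ} {tr : Transcript Sol} (h : PlayInv t L M tr) (x y : ℕ) :
    PlayInv t L M
      (.dist x y (capDist (denseGraph t (edgesOf t L tr)) L x y : ℝ) :: tr) := by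
  have hsub := subset_fixDist t L (edgesOf t L tr) x y
  have hle := denseGraph_fixDist_le t L (edgesOf t L tr) x y
  refine ⟨h.range, h.wf, h.sub, h.card_le, fun z hz hzc hzo => h.deleted z hz hzc
    (openSet_anti hsub hzo), fun v => edgeDeg_fixDist_lt h.deg x y v,
    (card_fixDist_le _ _ _ _ _).trans (Nat.succ_le_succ h.edges), ?_⟩
  intro u w v hv
  have h1 := capDist_anti (edgeGraph_mono hsub) L u w
  have h2 := capDist_anti hle L u w
  rcases List.mem_cons.1 hv with hv | hv
  · injection hv with h3 h4 h5
    subst h3 h4 h5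
    exact ⟨by exact_mod_cast capDist_fixDist_le t L (edgesOf t L tr) u w, by exact_mod_cast h2⟩
  · have h3 := h.answers u w v hv
    exact ⟨le_trans (by exact_mod_cast h1) h3.1, h3.2.trans (by exact_mod_cast h2)⟩

theorem PlayInv.finish {t : ℝ} {L M : ℕ} {tr : Transcript Sol} (h : PlayInv t L M tr) {o : Op}
    {e : Event Sol} (he : Finishes o e) : PlayInv t L M (e :: tr) := by
  rcases he with ⟨-, rfl⟩ | ⟨-, v, rfl⟩ | ⟨-, S, rfl⟩ <;>
    exact ⟨h.range, h.wf, h.sub, h.card_le, h.deleted, h.deg, h.edges,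
      fun x y v hv => h.answers x y v (by simpa using hv)⟩

theorem playInv_run {t : ℝ} (ht : 0 ≤ t) (L M : ℕ) {q : Op} (hq : IsAsk q) (alg : Algorithm Sol)
    (s : ℕ) : PlayInv t L M (run (graphAdversary Sol t L M q) alg s) := by
  induction s with
  | zero => exact PlayInv.nil ht L M
  | succ s ih =>
    rw [run_succ]
    rcases step_cases (graphAdversary Sol t L M q) alg (run (graphAdversary Sol t L M q) alg s)
      with ⟨-, h⟩ | ⟨o, x, y, -, h⟩ | ⟨o, e, -, he, h⟩ <;> rw [h]
    · exact ih.op hq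
    · exact ih.dist x y
    · exact ih.finish he

/-- Every graph between the two extreme ones yields a consistent metric. -/
theorem PlayInv.consistent {t : ℝ} {L M : ℕ} {tr : Transcript Sol} (h : PlayInv t L M tr)
    {Δ : ℝ} (hL : 1 ≤ L) (hΔ : (L : ℝ) ≤ Δ) {H : SimpleGraph ℕ}
    (h1 : edgeGraph (edgesOf t L tr) ≤ H) (h2 : H ≤ denseGraph t (edgesOf t L tr)) :
    Consistent Δ tr fun x y => (capDist H L x y : ℝ) := by
  refine ⟨metricOn_capDist _ H hL hΔ, fun x y v hv => ?_⟩
  have h3 := h.answers x y v hv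
  have h4 : (capDist H L x y : ℝ) ≤ capDist (edgeGraph (edgesOf t L tr)) L x y := by
    exact_mod_cast capDist_anti h1 L x y
  have h5 : (capDist (denseGraph t (edgesOf t L tr)) L x y : ℝ) ≤ capDist H L x y := by
    exact_mod_cast capDist_anti h2 L x y
  exact le_antisymm (h4.trans h3.1) (h3.2.trans h5)

theorem graphAdversary_legal {t : ℝ} (ht : 0 ≤ t) {L : ℕ} (M : ℕ) {q : Op} (hq : IsAsk q) {Δ : ℝ}
    (hL : 1 ≤ L) (hΔ : (L : ℝ) ≤ Δ) : (graphAdversary Sol t L M q).Legal Δ := fun alg s =>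
  have h := playInv_run ht L M hq alg s
  ⟨h.wf, _, h.consistent hL hΔ le_rfl le_sup_left⟩

/-! ### The adversary succeeds eventually -/

/-- The number of operations so far. -/
def numOps : Transcript Sol → ℕ
  | [] => 0
  | .op _ :: tr => numOps tr + 1
  | _ :: tr => numOps tr

/-- The number of operations that are being processed. -/
def numPending (tr : Transcript Sol) : ℕ := if (pending tr).isSome then 1 else 0

/-- The most recent operation, if any. -/
def lastOp : Transcript Sol → Option Op
  | [] => none
  | .op o :: _ => some o
  | _ :: tr => lastOp tr

theorem lastOp_eq_of_pending {tr : Transcript Sol} {o : Op} (h : pending tr = some o) :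
    lastOp tr = some o := by
  induction tr with
  | nil => simp [pending] at h
  | cons e tr ih => cases e <;> simp_all [pending, lastOp]

open Classical in
/-- Whether the most recent operation is the query `q`. -/
noncomputable def lastAsk (q : Op) (tr : Transcript Sol) : ℕ := if lastOp tr = some q then 1 else 0

/-- The algorithm is about to answer the query `q`, and all current points are open. -/
def AboutToAnswer (t : ℝ) (L : ℕ) (q : Op) (alg : Algorithm Sol) (tr : Transcript Sol) : Prop :=
  pending tr = some q ∧ alg.next tr = none ∧ ∀ x ∈ current tr, x ∈ openSet t (edgesOf t L tr)

/-- What holds until the adversary succeeds. -/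
structure CountInv (t : ℝ) (L M : ℕ) (q : Op) (tr : Transcript Sol) : Prop where
  ops : numOps tr + 2 * (current tr).card ≤ 3 * (inserted tr).card + lastAsk q tr
  length : tr.length + numPending tr ≤ 2 * numOps tr + numQueries tr
  full : lastOp tr = some q → M ≤ (inserted tr).card
  closed : lastOp tr = some q → pending tr = none →
    ∃ x ∈ current tr, x ∉ openSet t (edgesOf t L tr)

/-- Until the adversary succeeds, every answered query leaves a current point that is not open, so a
deletion comes next, and queries exceed deletions by at most one. With `I` points inserted and `D`
deleted this gives at most `I + 2 * D + 1` operations, which is `ops`. Each operation contributes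
its issue and its completion to the transcript, which is `length`. -/
theorem countInv_run {t : ℝ} (ht : 0 ≤ t) (L M : ℕ) {q : Op} (hq : IsAsk q) (alg : Algorithm Sol)
    (s : ℕ)
    (hs : ∀ s' < s, ¬ AboutToAnswer t L q alg (run (graphAdversary Sol t L M q) alg s')) :
    CountInv t L M q (run (graphAdversary Sol t L M q) alg s) := by
  induction s with
  | zero =>
    rw [run_zero]
    exact ⟨by simp [numOps, current], by simp [numPending, pending], by simp [lastOp],
      by simp [lastOp]⟩
  | succ s ih =>
    replace ih := ih fun s' h => hs s' (by omega)
    replace hs := hs s (by omega)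
    have hinv := playInv_run ht L M hq alg s
    rw [run_succ]
    revert ih hs hinv
    generalize run (graphAdversary Sol t L M q) alg s = tr
    intro ih hs hinv
    have hlen := ih.length
    have hops := ih.ops
    unfold step
    cases hp : pending tr with
    | none =>
      have hnp : numPending tr = 0 := by simp [numPending, hp]
      have hnp' (o : Op) : numPending (Event.op o :: tr) = 1 := by simp [numPending, pending]
      have hlen' (o : Op) : (Event.op o :: tr).length + numPending (Event.op o :: tr) ≤
          2 * numOps (Event.op o :: tr) + numQueries (Event.op o :: tr) := by
        simp only [List.length_cons, hnp', numOps, numQueries]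
        omega
      rcases nextOp_cases Sol t L M q tr with ⟨h1, h2⟩ | ⟨h1, x, hx, hxo, h2⟩ | ⟨h1, hop, h2⟩ <;>
        simp only [h2]
      · have hq' : Op.ins (inserted tr).card ≠ q := by rcases hq with rfl | rfl <;> simp
        have hla : lastAsk q tr = 0 := if_neg fun h => by have := ih.full h; omega
        have hnot : (inserted tr).card ∉ inserted tr := by
          rw [hinv.range]; simp
        refine ⟨?_, hlen' _, fun h => absurd (Option.some.inj h) hq',
          fun h => absurd (Option.some.inj h) hq'⟩
        simp only [numOps, current, inserted]
        rw [Finset.card_insert_of_notMem hnot,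
          Finset.card_insert_of_notMem fun h => hnot (hinv.sub h)]
        omega
      · have hq' : Op.del x ≠ q := by rcases hq with rfl | rfl <;> simp
        have hla : lastAsk q tr ≤ 1 := by unfold lastAsk; split_ifs <;> omega
        refine ⟨?_, hlen' _, fun h => absurd (Option.some.inj h) hq',
          fun h => absurd (Option.some.inj h) hq'⟩
        simp only [numOps, current, inserted]
        have := Finset.card_erase_add_one hx
        omega
      -- All points are open here, so the previous operation cannot have been `q`: its answer would
      -- have left a point that is not open.
      · have hla : lastAsk q tr = 0 := if_neg fun h => by
          obtain ⟨x, hx, hxo⟩ := ih.closed h hp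
          exact hxo (hop x hx)
        have hla' : lastAsk q (Event.op q :: tr) = 1 := if_pos rfl
        have h3 : inserted (Event.op q :: tr) = inserted tr := by rcases hq with rfl | rfl <;> rfl
        have h4 : current (Event.op q :: tr) = current tr := by rcases hq with rfl | rfl <;> rfl
        refine ⟨?_, hlen' _, fun _ => by rw [h3]; exact h1, fun _ h => by simp [pending] at h⟩
        rw [h3, h4, hla']
        simp only [numOps]
        omega
    | some o =>
      have hnp : numPending tr = 1 := by simp [numPending, hp]
      cases hn : alg.next tr with
      | some p =>
        refine ⟨hops, ?_, ih.full, fun _ h => ?_⟩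
        · have : numPending (Event.dist p.1 p.2
              ((graphAdversary Sol t L M q).answer tr p.1 p.2) :: tr) = 1 := by
            simp [numPending, pending, hp]
          simp only [List.length_cons, numOps, numQueries]
          omega
        · change pending tr = none at h
          rw [hp] at h; cases h
      | none =>
        have hcl : lastOp tr = some q → ∃ x ∈ current tr, x ∉ openSet t (edgesOf t L tr) := by
          intro h
          rw [lastOp_eq_of_pending hp] at h
          by_contra hno
          push Not at hno
          exact hs ⟨hp.trans h, hn, hno⟩
        cases o <;> refine ⟨hops, ?_, ih.full, fun h _ => hcl h⟩ <;>
        · simp only [numPending, pending, numOps, numQueries, List.length_cons,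
            Option.isSome_none, Bool.false_eq_true, if_false]
          omega

/-- Deletions are paid for by queries: a deleted point has degree at least `t`, a query adds at most
one edge, and an edge has two ends. -/
theorem card_deleted_mul_le {t : ℝ} {L M : ℕ} {tr : Transcript Sol} (h : PlayInv t L M tr) :
    (((inserted tr).card : ℝ) - (current tr).card) * t ≤ 2 * numQueries tr := by
  have h1 := (sum_edgeDeg_le (edgesOf t L tr) (inserted tr \ current tr)).trans
    (Nat.mul_le_mul_left 2 h.edges)
  have h2 : ∑ v ∈ inserted tr \ current tr, t ≤
      ∑ v ∈ inserted tr \ current tr, (edgeDeg (edgesOf t L tr) v : ℝ) :=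
    Finset.sum_le_sum fun v hv => not_lt.1
      (h.deleted v (Finset.mem_sdiff.1 hv).1 (Finset.mem_sdiff.1 hv).2)
  have h3 : (∑ v ∈ inserted tr \ current tr, (edgeDeg (edgesOf t L tr) v : ℝ)) ≤
      2 * numQueries tr := by exact_mod_cast h1
  rw [Finset.sum_const, nsmul_eq_mul, Finset.cast_card_sdiff h.sub] at h2
  exact h2.trans h3

theorem budget_le {F : ℕ → ℝ} {B : ℝ} {M : ℕ} (hF : ∀ n ≤ M, F n ≤ B) {A : Adversary Sol}
    {alg : Algorithm Sol} (hcard : ∀ s, (current (run A alg s)).card ≤ M) (s : ℕ) :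
    budget F (run A alg s) ≤ numOps (run A alg s) * B := by
  induction s with
  | zero => simp [run_zero, budget, numOps]
  | succ s ih =>
    have hc := hF _ (hcard s)
    rw [run_succ]
    rcases step_cases A alg (run A alg s) with ⟨-, h⟩ | ⟨o, x, y, -, h⟩ | ⟨o, e, -, he, h⟩ <;> rw [h]
    · simp only [budget, numOps]
      push_cast
      linarith
    · exact ih
    · rcases he with ⟨-, rfl⟩ | ⟨-, v, rfl⟩ | ⟨-, S, rfl⟩ <;> exact ih

theorem length_run (A : Adversary Sol) (alg : Algorithm Sol) (s : ℕ) :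
    (run A alg s).length = s := by
  induction s with
  | zero => rfl
  | succ s ih =>
    rw [run_succ]
    rcases step_cases A alg (run A alg s) with ⟨-, h⟩ | ⟨o, x, y, -, h⟩ | ⟨o, e, -, -, h⟩ <;>
      rw [h, List.length_cons, ih]

/-- If an algorithm makes amortized at most `t / 8` distance queries per operation, then at some
time it answers the query `q` while at least half of the points are present, all of them open. -/
theorem exists_aboutToAnswer {t : ℝ} (ht : 0 < t) (L m : ℕ) {q : Op} (hq : IsAsk q)
    {F : ℕ → ℝ} (hF : ∀ n ≤ 2 * m, F n ≤ t / 8) (alg : Algorithm Sol)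
    (halg : AmortizedQueries (graphAdversary Sol t L (2 * m) q) alg F) :
    ∃ s, AboutToAnswer t L q alg (run (graphAdversary Sol t L (2 * m) q) alg s) ∧
      m ≤ (current (run (graphAdversary Sol t L (2 * m) q) alg s)).card ∧
      (current (run (graphAdversary Sol t L (2 * m) q) alg s)).card ≤ 2 * m := by
  have hinv := playInv_run ht.le L (2 * m) hq alg
  have hcard s : (current (run (graphAdversary Sol t L (2 * m) q) alg s)).card ≤ 2 * m :=
    (Finset.card_le_card (hinv s).sub).trans (hinv s).card_le
  have key s (hc : CountInv t L (2 * m) q (run (graphAdversary Sol t L (2 * m) q) alg s)) :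
      4 * (inserted (run (graphAdversary Sol t L (2 * m) q) alg s)).card ≤
        numOps (run (graphAdversary Sol t L (2 * m) q) alg s) +
        4 * (current (run (graphAdversary Sol t L (2 * m) q) alg s)).card ∧
      (numQueries (run (graphAdversary Sol t L (2 * m) q) alg s) : ℝ) ≤
        numOps (run (graphAdversary Sol t L (2 * m) q) alg s) * (t / 8) := by
    have h1 := card_deleted_mul_le (hinv s)
    have h2 := (halg s).trans (budget_le hF hcard s)
    refine ⟨?_, h2⟩
    -- With `D` deleted points, `D * t` is at most twice the number of queries, hence at most
    -- `numOps * t / 4`.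
    have h3 : (4 * (inserted (run (graphAdversary Sol t L (2 * m) q) alg s)).card : ℝ) ≤
        numOps (run (graphAdversary Sol t L (2 * m) q) alg s) +
        4 * (current (run (graphAdversary Sol t L (2 * m) q) alg s)).card := by
      refine le_of_mul_le_mul_right ?_ ht
      linarith
    exact_mod_cast h3
  have hlast (tr : Transcript Sol) : lastAsk q tr ≤ 1 := by unfold lastAsk; split_ifs <;> omega
  have hex : ∃ s, AboutToAnswer t L q alg (run (graphAdversary Sol t L (2 * m) q) alg s) := by
    by_contra hno
    push Not at hno
    -- Without success there would be at most `4 * m + 1` operations, each costing two events and on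
    -- average at most `t / 8` queries; a longer play is impossible.
    obtain ⟨s, hs⟩ := exists_nat_gt (2 * (4 * m + 1) + (4 * m + 1) * (t / 8) : ℝ)
    have hc := countInv_run ht.le L (2 * m) hq alg s fun s' _ => hno s'
    obtain ⟨h1, h2⟩ := key s hc
    have h3 := hc.ops
    have h4 := hc.length
    rw [length_run] at h4
    have h5 := hlast (run (graphAdversary Sol t L (2 * m) q) alg s)
    have h6 := (hinv s).card_le
    have h7 : numOps (run (graphAdversary Sol t L (2 * m) q) alg s) ≤ 4 * m + 1 := by omega
    have h8 : (s : ℝ) ≤ 2 * numOps (run (graphAdversary Sol t L (2 * m) q) alg s) +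
        numQueries (run (graphAdversary Sol t L (2 * m) q) alg s) := by
      exact_mod_cast (Nat.le_add_right _ _).trans h4
    have h9 : (numOps (run (graphAdversary Sol t L (2 * m) q) alg s) : ℝ) ≤ 4 * m + 1 := by
      exact_mod_cast h7
    nlinarith
  classical
  -- The first success is taken, since `CountInv` is only guaranteed up to it. There `4 * D` is at
  -- most `2 * m + 2 * D + 1`, so `D` is at most `m`.
  refine ⟨Nat.find hex, Nat.find_spec hex, ?_, hcard _⟩
  have hc := countInv_run ht.le L (2 * m) hq alg (Nat.find hex) fun s' h => Nat.find_min hex h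
  have h1 := (key _ hc).1
  have h2 := hc.full (lastOp_eq_of_pending (Nat.find_spec hex).1)
  have h3 := hc.ops
  have h4 := hlast (run (graphAdversary Sol t L (2 * m) q) alg (Nat.find hex))
  have h5 := (hinv (Nat.find hex)).card_le
  omega

end DynClust

namespace DynClust

/-! ### Optimal values -/

theorem distTo_le {d : ℕ → ℕ → ℝ} {C : Finset ℕ} {c : ℕ} (hc : c ∈ C) (x : ℕ) :
    distTo d C x ≤ d x c :=
  ciInf_le (Set.finite_range fun c : C => d x c).bddBelow (⟨c, hc⟩ : C)

/-- A real infimum over the empty set is `0`, so nonemptiness of `C` is essential. -/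
theorem le_distTo {d : ℕ → ℕ → ℝ} {C : Finset ℕ} (hC : C.Nonempty) {x : ℕ} {a : ℝ}
    (h : ∀ c ∈ C, a ≤ d x c) : a ≤ distTo d C x :=
  haveI : Nonempty C := hC.to_subtype
  le_ciInf fun c => h c c.2

theorem distTo_nonneg {d : ℕ → ℕ → ℝ} (hd : ∀ x y, 0 ≤ d x y) (C : Finset ℕ) (x : ℕ) :
    0 ≤ distTo d C x :=
  Real.iInf_nonneg fun c => hd x c

theorem diam_nonneg {d : ℕ → ℕ → ℝ} (hd : ∀ x y, 0 ≤ d x y) (S : Finset ℕ) : 0 ≤ diam d S :=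
  Real.iSup_nonneg fun x => Real.iSup_nonneg fun y => hd x y

theorem le_diam {d : ℕ → ℕ → ℝ} {S : Finset ℕ} {x y : ℕ} (hx : x ∈ S) (hy : y ∈ S) :
    d x y ≤ diam d S :=
  (le_ciSup (Set.finite_range fun y : S => d x y).bddAbove (⟨y, hy⟩ : S)).trans
    (le_ciSup (Set.finite_range fun x : S => ⨆ y : S, d x y).bddAbove (⟨x, hx⟩ : S))

theorem opt_le_cost {prob : Problem} {P pool : Finset ℕ} {d : ℕ → ℕ → ℝ} {k : ℕ}
    (hnn : ∀ S, prob.Feasible P pool d S → 0 ≤ prob.cost P d S) {S : prob.Sol}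
    (hS : prob.Feasible P pool d S) (hk : prob.size S ≤ k) :
    opt prob P pool d k ≤ prob.cost P d S :=
  csInf_le ⟨0, by rintro r ⟨T, hT, -, rfl⟩; exact hnn T hT⟩ ⟨S, hS, hk, rfl⟩

theorem opt_nonneg {prob : Problem} {P pool : Finset ℕ} {d : ℕ → ℕ → ℝ} {k : ℕ}
    (hnn : ∀ S, prob.Feasible P pool d S → 0 ≤ prob.cost P d S) : 0 ≤ opt prob P pool d k :=
  Real.sInf_nonneg (by rintro r ⟨T, hT, -, rfl⟩; exact hnn T hT)

/-- Without a feasible solution the real `sInf` would be `0`; hence `hex`. -/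
theorem le_opt {prob : Problem} {P pool : Finset ℕ} {d : ℕ → ℕ → ℝ} {k : ℕ} {a : ℝ}
    (hex : ∃ S, prob.Feasible P pool d S ∧ prob.size S ≤ k)
    (h : ∀ S, prob.Feasible P pool d S → prob.size S ≤ k → a ≤ prob.cost P d S) :
    a ≤ opt prob P pool d k := by
  obtain ⟨S, hS, hk⟩ := hex
  refine le_csInf ⟨_, S, hS, hk, rfl⟩ ?_
  rintro r ⟨T, hT, hk, rfl⟩
  exact h T hT hk

/-- No center set of at most `k` points is at distance less than `a` from all points of `P`. -/
def Scattered (P : Finset ℕ) (d : ℕ → ℕ → ℝ) (k : ℕ) (a : ℝ) : Prop :=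
  ∀ C : Finset ℕ, C.card ≤ k → ∃ x ∈ P, ∀ c ∈ C, a ≤ d x c

/-- The optimal value is at most `1` if all distances are at most `1`, and at least `a` if `P` is
scattered. -/
structure ValueGap (prob : Problem) : Prop where
  nonneg : ∀ (P pool : Finset ℕ) (d : ℕ → ℕ → ℝ) (k : ℕ), (∀ x y, 0 ≤ d x y) →
    0 ≤ opt prob P pool d k
  le_one : ∀ (P pool : Finset ℕ) (d : ℕ → ℕ → ℝ) (k : ℕ), 1 ≤ k → P.Nonempty → P ⊆ pool →
    (∀ x y, 0 ≤ d x y) → (∀ x ∈ P, ∀ y ∈ P, d x y ≤ 1) → opt prob P pool d k ≤ 1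
  le_opt : ∀ (P pool : Finset ℕ) (d : ℕ → ℕ → ℝ) (k : ℕ) (a : ℝ), 1 ≤ k → P.Nonempty → P ⊆ pool →
    (∀ x y, 0 ≤ d x y) → Scattered P d k a → a ≤ opt prob P pool d k

theorem kCenter_valueGap : ValueGap kCenter := by
  have hnn (P pool : Finset ℕ) (d : ℕ → ℕ → ℝ) (hd : ∀ x y, 0 ≤ d x y) (S : kCenter.Sol)
      (_ : kCenter.Feasible P pool d S) : 0 ≤ kCenter.cost P d S :=
    Real.iSup_nonneg fun x => distTo_nonneg hd _ _
  have hfeas {P pool : Finset ℕ} (d : ℕ → ℕ → ℝ) {x : ℕ} (hx : x ∈ P) (hP : P ⊆ pool) :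
      kCenter.Feasible P pool d ({x} : Finset ℕ) :=
    ⟨Finset.singleton_subset_iff.2 (hP hx), fun _ => Finset.singleton_nonempty x⟩
  refine ⟨fun P pool d k hd => opt_nonneg (hnn P pool d hd), ?_, ?_⟩
  · rintro P pool d k hk ⟨x, hx⟩ hP hd h1
    refine (opt_le_cost (hnn P pool d hd) (hfeas d hx hP)
      ((Finset.card_singleton x).trans_le hk)).trans ?_
    have : Nonempty P := ⟨⟨x, hx⟩⟩
    exact ciSup_le fun y => (distTo_le (Finset.mem_singleton_self x) _).trans (h1 y y.2 x hx)
  · rintro P pool d k a hk ⟨x, hx⟩ hP hd h1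
    refine le_opt ⟨_, hfeas d hx hP, (Finset.card_singleton x).trans_le hk⟩ fun C hC hCk => ?_
    obtain ⟨y, hy, hyC⟩ := h1 C hCk
    exact (le_distTo (hC.2 ⟨x, hx⟩) hyC).trans
      (le_ciSup (Set.finite_range fun x : P => distTo d C x).bddAbove (⟨y, hy⟩ : P))

theorem kSumRadii_valueGap : ValueGap kSumRadii := by
  have hnn (P pool : Finset ℕ) (d : ℕ → ℕ → ℝ) (S : kSumRadii.Sol)
      (hS : kSumRadii.Feasible P pool d S) : 0 ≤ kSumRadii.cost P d S :=
    Finset.sum_nonneg fun c hc => (hS.1 c hc).2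
  have hfeas {P pool : Finset ℕ} {d : ℕ → ℕ → ℝ} {x : ℕ} (hx : x ∈ P) (hP : P ⊆ pool) {R : ℝ}
      (hR : 0 ≤ R) (h : ∀ y ∈ P, d y x ≤ R) :
      kSumRadii.Feasible P pool d ({(x, R)} : Finset (ℕ × ℝ)) :=
    ⟨fun c hc => by rw [Finset.mem_singleton.1 hc]; exact ⟨hP hx, hR⟩,
      fun y hy => ⟨(x, R), Finset.mem_singleton_self _, h y hy⟩⟩
  refine ⟨fun P pool d k _ => opt_nonneg (hnn P pool d), ?_, ?_⟩
  · rintro P pool d k hk ⟨x, hx⟩ hP hd h1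
    refine (opt_le_cost (hnn P pool d) (hfeas hx hP zero_le_one fun y hy => h1 y hy x hx)
      ((Finset.card_singleton (x, (1 : ℝ))).trans_le hk)).trans ?_
    exact (Finset.sum_singleton _ _).le
  · rintro P pool d k a hk ⟨x, hx⟩ hP hd h1
    -- Only the existence of a solution matters here; the sum of all distances to `x` is a radius
    -- that surely covers `P`.
    refine le_opt ⟨_, hfeas hx hP (Finset.sum_nonneg fun y _ => hd y x) fun y hy =>
      Finset.single_le_sum (f := fun y => d y x) (fun z _ => hd z x) hy,
      (Finset.card_singleton (x, ∑ y ∈ P, d y x)).trans_le hk⟩ fun (S : Finset (ℕ × ℝ)) hS hSk => ?_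
    obtain ⟨y, hy, hyC⟩ := h1 (S.image Prod.fst) (Finset.card_image_le.trans hSk)
    obtain ⟨c, hc, hyc⟩ := hS.2 y hy
    exact (hyC _ (Finset.mem_image_of_mem _ hc)).trans (hyc.trans
      (Finset.single_le_sum (f := Prod.snd) (fun z hz => (hS.1 z hz).2) hc))

theorem kSumDiameters_valueGap : ValueGap kSumDiameters := by
  have hnn (P pool : Finset ℕ) (d : ℕ → ℕ → ℝ) (hd : ∀ x y, 0 ≤ d x y) (S : kSumDiameters.Sol)
      (_ : kSumDiameters.Feasible P pool d S) : 0 ≤ kSumDiameters.cost P d S :=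
    Finset.sum_nonneg fun T _ => diam_nonneg hd T
  have hfeas {P : Finset ℕ} (pool : Finset ℕ) (d : ℕ → ℕ → ℝ) (hP : P.Nonempty) :
      kSumDiameters.Feasible P pool d ({P} : Finset (Finset ℕ)) :=
    ⟨fun T hT => by rw [Finset.mem_singleton.1 hT]; exact hP,
      fun T hT U hU h => absurd ((Finset.mem_singleton.1 hT).trans
        (Finset.mem_singleton.1 hU).symm) h, Finset.singleton_biUnion⟩
  refine ⟨fun P pool d k hd => opt_nonneg (hnn P pool d hd), ?_, ?_⟩
  · intro P pool d k hk hne hP hd h1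
    refine (opt_le_cost (hnn P pool d hd) (hfeas pool d hne)
      ((Finset.card_singleton P).trans_le hk)).trans ?_
    refine (Finset.sum_singleton _ _).le.trans ?_
    have : Nonempty P := hne.to_subtype
    exact ciSup_le fun x => ciSup_le fun y => h1 x x.2 y y.2
  · intro P pool d k a hk hne hP hd h1
    refine le_opt ⟨_, hfeas pool d hne, (Finset.card_singleton P).trans_le hk⟩
      fun (S : Finset (Finset ℕ)) hS hSk => ?_
    classical
    -- One representative per cluster turns the partition into a center set; clusters are nonempty,
    -- so the default `0` plays no role.
    let rep : Finset ℕ → ℕ := fun T => if h : T.Nonempty then h.choose else 0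
    obtain ⟨y, hy, hyC⟩ := h1 (S.image rep) (Finset.card_image_le.trans hSk)
    have hy' : y ∈ S.biUnion id := by rw [hS.2.2]; exact hy
    obtain ⟨T, hT, hyT⟩ := Finset.mem_biUnion.1 hy'
    have hrep : rep T ∈ T := by
      simp only [rep, hS.1 T hT, dif_pos]
      exact (hS.1 T hT).choose_spec
    exact (hyC _ (Finset.mem_image_of_mem _ hT)).trans ((le_diam hyT hrep).trans
      (Finset.single_le_sum (f := fun T => diam d T) (fun U _ => diam_nonneg hd U) hT))

theorem current_subset_pool {Sol : Type} {tr : Transcript Sol} (h : current tr ⊆ inserted tr)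
    (allowDeleted : Bool) : current tr ⊆ pool allowDeleted tr := by
  unfold pool
  split_ifs
  · exact h
  · exact subset_rfl

theorem step_of_aboutToAnswer {Sol : Type} {t : ℝ} {L : ℕ} {q : Op} {A : Adversary Sol}
    {alg : Algorithm Sol} {tr : Transcript Sol} (h : AboutToAnswer t L q alg tr) :
    (q = .askValue → step A alg tr = .value (alg.value tr) :: tr) ∧
      (q = .askSolution → step A alg tr = .solution (alg.solution tr) :: tr) := by
  unfold step
  rw [h.1, h.2.1]
  exact ⟨by rintro rfl; rfl, by rintro rfl; rfl⟩

/-! ### Value-queries -/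

/-- The adversary forces the ratio `r + 1` in the answers to value-queries. -/
theorem ValueGap.forcesRatio {prob : Problem} (hprob : ValueGap prob) (allowDeleted : Bool)
    {k g m r : ℕ} (hk : 1 ≤ k) (hm : 1 ≤ m) {F : ℕ → ℝ} {Δ a : ℝ} {bound : ℕ → ℝ} (ha : 1 ≤ a)
    (hF : ∀ n ≤ 2 * m, F n ≤ a) (hΔ : ((r + 1 : ℕ) : ℝ) ≤ Δ)
    (hcount : k * (16 * a) ^ r < m)
    (hbound : ∀ n, m ≤ n → n ≤ 2 * m → bound n ≤ (r + 1 : ℕ)) :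
    ForcesRatio prob allowDeleted k g F Δ m bound := by
  have ht : (0 : ℝ) < 8 * a := by linarith
  have hq : IsAsk .askValue := Or.inl rfl
  refine ⟨graphAdversary prob.Sol (8 * a) (r + 1) (2 * m) .askValue,
    graphAdversary_legal ht.le _ hq (by omega) hΔ, fun alg α halg hval _ => ?_⟩
  obtain ⟨s, hs, hcm, hcm'⟩ := exists_aboutToAnswer ht (r + 1) m hq
    (fun n hn => (hF n hn).trans (by linarith)) alg halg
  have hinv := playInv_run ht.le (r + 1) (2 * m) hq alg s
  have hrun := (run_succ _ alg s).trans ((step_of_aboutToAnswer hs).1 rfl)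
  generalize run (graphAdversary prob.Sol (8 * a) (r + 1) (2 * m) .askValue) alg s = tr
    at hs hcm hcm' hinv hrun
  have hval := hval _ _ _ hrun
  have hd1 := hinv.consistent (by omega) hΔ le_rfl le_sup_left
  have hd2 := hinv.consistent (by omega) hΔ
    (H := denseGraph (8 * a) (edgesOf (8 * a) (r + 1) tr)) le_sup_left le_rfl
  have hsub := current_subset_pool hinv.sub allowDeleted
  have hne : (current tr).Nonempty := Finset.card_pos.1 (by omega)
  have hlow := hprob.le_opt (current tr) (pool allowDeleted tr) k ((r + 1 : ℕ) : ℝ) hk hne hsub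
    (d := fun x y => (capDist (edgeGraph (edgesOf (8 * a) (r + 1) tr)) (r + 1) x y : ℝ))
    (fun x y => by positivity) (by
      intro C hC
      by_contra hno
      push Not at hno
      -- Degrees are below `8 * a + 1`, and `8 * a + 2 ≤ 16 * a` because `1 ≤ a`.
      have h1 : ((current tr).card : ℝ) ≤ C.card * (16 * a) ^ r :=
        card_le_of_near (E := edgesOf (8 * a) (r + 1) tr)
          (fun v => by linarith [hinv.deg v]) fun x hx => by
            obtain ⟨c, hc, hxc⟩ := hno x hx
            refine ⟨c, hc, ?_⟩
            have : capDist (edgeGraph (edgesOf (8 * a) (r + 1) tr)) (r + 1) x c < r + 1 := by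
              exact_mod_cast hxc
            omega
      have h2 : (C.card : ℝ) * (16 * a) ^ r ≤ k * (16 * a) ^ r := by gcongr
      have h3 : (m : ℝ) ≤ (current tr).card := by exact_mod_cast hcm
      linarith)
  have hone := hprob.le_one (current tr) (pool allowDeleted tr) k hk hne hsub
    (d := fun x y => (capDist (denseGraph (8 * a) (edgesOf (8 * a) (r + 1) tr)) (r + 1) x y : ℝ))
    (fun x y => by positivity) (fun x hx y hy => by
      exact_mod_cast capDist_le_one (G := denseGraph (8 * a) (edgesOf (8 * a) (r + 1) tr))
        fun hxy => Or.inr ⟨hxy, hs.2.2 x hx, hs.2.2 y hy⟩)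
  have hnn := hprob.nonneg (current tr) (pool allowDeleted tr)
    (fun x y => (capDist (denseGraph (8 * a) (edgesOf (8 * a) (r + 1) tr)) (r + 1) x y : ℝ)) k
    (fun x y => by positivity)
  refine ⟨(current tr).card, hcm, by omega, (hbound _ hcm hcm').trans ?_⟩
  -- The one reported value is at least the sparse optimum, hence at least `r + 1`, and at most `α`
  -- times the dense optimum, which is at most 1.
  have h1 := (hlow.trans (hval _ hd1).1).trans (hval _ hd2).2
  have h2 : (1 : ℝ) ≤ ((r + 1 : ℕ) : ℝ) := by push_cast; linarith [Nat.cast_nonneg (α := ℝ) r]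
  have h3 : 0 ≤ α (current tr).card := by
    by_contra hneg
    nlinarith
  nlinarith

/-! ### Solution-queries -/

theorem kpClustering_cost_nonneg {p : ℝ} {P : Finset ℕ} {d : ℕ → ℕ → ℝ} (hd : ∀ x y, 0 ≤ d x y)
    (C : (kpClustering p).Sol) : 0 ≤ (kpClustering p).cost P d C :=
  Finset.sum_nonneg fun _ _ => Real.rpow_nonneg (distTo_nonneg hd _ _) _

/-- If most points are at distance `l` from `C`, but close to one another, then the cost of `C`
is far from optimal. -/
theorem le_ratio_of_far {p l a : ℝ} (hp : 0 ≤ p) (hl : 1 ≤ l) {P pool C near : Finset ℕ} {k : ℕ}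
    {d : ℕ → ℕ → ℝ} (hk : 1 ≤ k) (hP : P.Nonempty) (hpool : P ⊆ pool) (hC : C.Nonempty)
    (hd : ∀ x y, 0 ≤ d x y) (hdl : ∀ x y, d x y ≤ l)
    (hnear : near ⊆ P) (hcard : (near.card : ℝ) * l ^ p ≤ P.card / 2)
    (hfar : ∀ x ∈ P \ near, ∀ c ∈ C, l ≤ d x c)
    (hone : ∀ x ∈ P \ near, ∀ y ∈ P \ near, d x y ≤ 1)
    (ha : (kpClustering p).cost P d C ≤ a * opt (kpClustering p) P pool d k) :
    l ^ p / 3 ≤ a := by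
  have hl0 : 0 ≤ l := by linarith
  have hlp : 1 ≤ l ^ p := Real.one_le_rpow hl hp
  have hn : (0 : ℝ) < P.card := by exact_mod_cast hP.card_pos
  -- As `1 ≤ l ^ p`, the hypothesis `hcard` also bounds the number of near points by half of all
  -- points.
  have hfarcard : (P.card : ℝ) / 2 ≤ (P \ near).card := by
    rw [Finset.cast_card_sdiff hnear]
    nlinarith [Nat.cast_nonneg (α := ℝ) near.card]
  have hcost : (P.card : ℝ) / 2 * l ^ p ≤ (kpClustering p).cost P d C := by
    calc (P.card : ℝ) / 2 * l ^ p ≤ (P \ near).card * l ^ p := by gcongr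
      _ = ∑ x ∈ P \ near, l ^ p := by simp
      _ ≤ ∑ x ∈ P \ near, distTo d C x ^ p := Finset.sum_le_sum fun x hx =>
          Real.rpow_le_rpow hl0 (le_distTo hC (hfar x hx)) hp
      _ ≤ ∑ x ∈ P, distTo d C x ^ p :=
          Finset.sum_le_sum_of_subset_of_nonneg Finset.sdiff_subset fun _ _ _ =>
            Real.rpow_nonneg (distTo_nonneg hd _ _) _
  obtain ⟨x, hx⟩ : (P \ near).Nonempty := by
    refine Finset.card_pos.1 ?_
    have : (0 : ℝ) < (P \ near).card := by linarith
    exact_mod_cast this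
  -- A single center at a far point `x` pays at most 1 per far point and `l ^ p` per near point, the
  -- latter adding up to at most `P.card / 2`.
  have hopt : opt (kpClustering p) P pool d k ≤ 3 / 2 * P.card := by
    have hfeas : (kpClustering p).Feasible P pool d ({x} : Finset ℕ) :=
      ⟨Finset.singleton_subset_iff.2 (hpool (Finset.mem_sdiff.1 hx).1),
        fun _ => Finset.singleton_nonempty x⟩
    refine (opt_le_cost (fun C _ => kpClustering_cost_nonneg hd C) hfeas
      ((Finset.card_singleton x).trans_le hk)).trans ?_
    have hx1 (y : ℕ) : distTo d {x} y ≤ d y x := distTo_le (Finset.mem_singleton_self x) y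
    calc ∑ y ∈ P, distTo d {x} y ^ p
        = ∑ y ∈ P \ near, distTo d {x} y ^ p + ∑ y ∈ near, distTo d {x} y ^ p :=
          (Finset.sum_sdiff hnear).symm
      _ ≤ ∑ y ∈ P \ near, (1 : ℝ) + ∑ y ∈ near, l ^ p := by
          refine add_le_add (Finset.sum_le_sum fun y hy => ?_) (Finset.sum_le_sum fun y hy => ?_)
          · exact Real.rpow_le_one (distTo_nonneg hd _ _) ((hx1 y).trans (hone y hy x hx)) hp
          · exact Real.rpow_le_rpow (distTo_nonneg hd _ _) ((hx1 y).trans (hdl y x)) hp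
      _ = (P \ near).card + near.card * l ^ p := by simp
      _ ≤ P.card + P.card / 2 := by
          refine add_le_add ?_ hcard
          exact_mod_cast Finset.card_le_card Finset.sdiff_subset
      _ = 3 / 2 * P.card := by ring
  have hopt0 : 0 ≤ opt (kpClustering p) P pool d k :=
    opt_nonneg fun C _ => kpClustering_cost_nonneg hd C
  have h1 := hcost.trans ha
  have h2 : 0 ≤ a := by
    by_contra hneg
    nlinarith
  have h3 : (P.card : ℝ) * (l ^ p / 3) ≤ P.card * a := by nlinarith
  exact le_of_mul_le_mul_left h3 hn

/-- The adversary forces the ratio `(r + 1) ^ p / 3` in the answers to solution-queries. -/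
theorem kpClustering_forcesSolutionRatio (allowDeleted : Bool) {p : ℝ} (hp : 0 ≤ p)
    {k g m r : ℕ} (hk : 1 ≤ k) (hm : 1 ≤ m) {F : ℕ → ℝ} {Δ a : ℝ} {bound : ℕ → ℝ} (ha : 1 ≤ a)
    (hF : ∀ n ≤ 2 * m, F n ≤ a) (hΔ : ((r + 1 : ℕ) : ℝ) ≤ Δ)
    (hcount : g * (16 * a) ^ r * ((r + 1 : ℕ) : ℝ) ^ p ≤ m / 2)
    (hbound : ∀ n, m ≤ n → n ≤ 2 * m → bound n ≤ ((r + 1 : ℕ) : ℝ) ^ p / 3) :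
    ForcesSolutionRatio (kpClustering p) allowDeleted k g F Δ m bound := by
  have ht : (0 : ℝ) < 8 * a := by linarith
  have hq : IsAsk .askSolution := Or.inr rfl
  refine ⟨graphAdversary _ (8 * a) (r + 1) (2 * m) .askSolution,
    graphAdversary_legal ht.le _ hq (by omega) hΔ, fun alg α halg hsol => ?_⟩
  obtain ⟨s, hs, hcm, hcm'⟩ := exists_aboutToAnswer ht (r + 1) m hq
    (fun n hn => (hF n hn).trans (by linarith)) alg halg
  have hinv := playInv_run ht.le (r + 1) (2 * m) hq alg s
  have hrun := (run_succ _ alg s).trans ((step_of_aboutToAnswer hs).2 rfl)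
  generalize run (graphAdversary (kpClustering p).Sol (8 * a) (r + 1) (2 * m) .askSolution) alg s
    = tr at hs hcm hcm' hinv hrun
  have hsol := hsol _ _ _ hrun
  -- Feasibility and size are extracted with the sparse metric, because the metric that refutes the
  -- solution is built from it.
  obtain ⟨hfeas, hsize, -⟩ := hsol _ (hinv.consistent (by omega) hΔ le_rfl le_sup_left)
  have hne : (current tr).Nonempty := Finset.card_pos.1 (by omega)
  generalize alg.solution tr = C at hsol hfeas hsize
  change Finset ℕ at C
  replace hsize : C.card ≤ g := hsize
  have hC : C.Nonempty := hfeas.2 hne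
  set G := edgeGraph (edgesOf (8 * a) (r + 1) tr) with hG
  classical
  let near := (current tr).filter fun x => ∃ c ∈ C, capDist G (r + 1) x c ≤ r
  have hfar : ∀ x ∈ current tr \ near, ∀ c ∈ C, r + 1 ≤ capDist G (r + 1) x c := by
    intro x hx c hc
    rw [Finset.mem_sdiff, Finset.mem_filter] at hx
    by_contra hlt
    exact hx.2 ⟨hx.1, c, hc, by omega⟩
  -- Only the far points are joined; all current points are open, so this graph still lies below the
  -- dense one.
  let S : Set ℕ := ↑(current tr \ near)
  have hH : G ⊔ cliqueOn S ≤ denseGraph (8 * a) (edgesOf (8 * a) (r + 1) tr) :=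
    sup_le_sup_left (cliqueOn_mono fun x hx => hs.2.2 x
      (Finset.mem_sdiff.1 (Finset.mem_coe.1 hx)).1) _
  have hd := hinv.consistent (by omega) hΔ le_sup_left hH
  have hnearcard : (near.card : ℝ) ≤ g * (16 * a) ^ r := by
    refine (card_le_of_near (E := edgesOf (8 * a) (r + 1) tr) (K := 16 * a)
      (fun v => by linarith [hinv.deg v]) fun x hx => (Finset.mem_filter.1 hx).2).trans ?_
    gcongr
  refine ⟨(current tr).card, hcm, by omega, (hbound _ hcm hcm').trans ?_⟩
  refine le_ratio_of_far hp (by push_cast; linarith [Nat.cast_nonneg (α := ℝ) r]) hk hne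
    (current_subset_pool hinv.sub allowDeleted) hC (near := near)
    (d := fun x y => (capDist (G ⊔ cliqueOn S) (r + 1) x y : ℝ))
    (fun x y => by positivity) (fun x y => by exact_mod_cast capDist_le)
    (Finset.filter_subset _ _) ?_ ?_ ?_ (hsol _ hd).2.2
  · have h1 : (m : ℝ) ≤ (current tr).card := by exact_mod_cast hcm
    have h2 : (near.card : ℝ) * ((r + 1 : ℕ) : ℝ) ^ p ≤
        g * (16 * a) ^ r * ((r + 1 : ℕ) : ℝ) ^ p := by gcongr
    linarith
  · intro x hx c hc
    exact_mod_cast le_capDist_sup_cliqueOn (G := G) (S := S) (Finset.mem_coe.2 hx)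
      fun z hz => hfar z (Finset.mem_coe.1 hz) c hc
  · intro x hx y hy
    exact_mod_cast capDist_le_one (G := G ⊔ cliqueOn S) fun hxy => Or.inr
      ⟨hxy, Finset.mem_coe.2 hx, Finset.mem_coe.2 hy⟩

theorem kMedian_eq : kMedian = kpClustering 1 := by
  simp [kMedian, kpClustering]

theorem kMeans_eq : kMeans = kpClustering 2 := by
  simp [kMeans, kpClustering]

end DynClust

namespace DynClust

/-! ### Parameters -/

theorem succ_le_two_pow (r : ℕ) : ((r + 1 : ℕ) : ℝ) ≤ 2 ^ r := by
  exact_mod_cast Nat.lt_two_pow_self (n := r)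

/-- Written as powers of 2, `16 * a` has exponent `4 + logb 2 a`, and `r + 1 ≤ 2 ^ r` turns the last
factor into a contribution `r * w`. -/
theorem growth_le_sqrt {a w x : ℝ} {r : ℕ} (ha : 1 ≤ a) (hw : 0 ≤ w) (hx : 0 < x)
    (h : r * (4 + w + Real.logb 2 a) ≤ Real.logb 2 x / 2) :
    (16 * a) ^ r * ((r + 1 : ℕ) : ℝ) ^ w ≤ √x := by
  have ha0 : 0 < a := by linarith
  have h16 : (16 * a) ^ r = (2 : ℝ) ^ (r * (4 + Real.logb 2 a)) := by
    rw [mul_comm (r : ℝ), Real.rpow_mul_natCast zero_le_two, Real.rpow_add zero_lt_two,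
      Real.rpow_logb zero_lt_two (by norm_num) ha0]
    norm_num
  calc (16 * a) ^ r * ((r + 1 : ℕ) : ℝ) ^ w
      ≤ (16 * a) ^ r * ((2 : ℝ) ^ r) ^ w := by
        gcongr
        exact succ_le_two_pow r
    _ = (2 : ℝ) ^ (r * (4 + w + Real.logb 2 a)) := by
        rw [h16, ← Real.rpow_natCast, ← Real.rpow_mul zero_le_two, ← Real.rpow_add zero_lt_two]
        congr 1
        ring
    _ ≤ (2 : ℝ) ^ (Real.logb 2 x / 2) := Real.rpow_le_rpow_of_exponent_le one_le_two h
    _ = √x := by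
        rw [div_eq_mul_one_div, Real.rpow_mul zero_le_two,
          Real.rpow_logb zero_lt_two (by norm_num) hx, Real.sqrt_eq_rpow]

/-- This keeps the truncation level `r + 1` below `m`, hence below `Δ`. -/
theorem succ_le_of_growth {a x : ℝ} {r : ℕ} (ha : 1 ≤ a) (h : (16 * a) ^ r ≤ x) :
    ((r + 1 : ℕ) : ℝ) ≤ x :=
  (succ_le_two_pow r).trans ((pow_le_pow_left₀ zero_le_two (by linarith) r).trans h)

/-- Used with `c = 2`, where the condition reads `8 * g ^ 2 ≤ m`; this is the source of the
threshold `N`. -/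
theorem mul_sqrt_le {g c m : ℝ} (hc : 0 < c) (hm : 0 ≤ m) (h : 2 * (g * c) ^ 2 ≤ m) :
    g * √(2 * m) ≤ m / c := by
  rw [le_div_iff₀ hc, mul_right_comm]
  refine le_of_sq_le_sq ?_ hm
  rw [mul_pow, Real.sq_sqrt (by linarith)]
  nlinarith

theorem sqrt_two_mul_le {m : ℝ} (hm : 2 ≤ m) : √(2 * m) ≤ m := by
  rw [Real.sqrt_le_left (by linarith)]
  nlinarith

theorem logb_two_mono {x y : ℝ} (hx : 0 < x) (h : x ≤ y) : Real.logb 2 x ≤ Real.logb 2 y :=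
  Real.logb_le_logb_of_le one_lt_two hx h

/-- The lower bound that results from the answers to value-queries. -/
theorem ValueGap.forcesRatio_log {prob : Problem} (hprob : ValueGap prob) (allowDeleted : Bool)
    {k g m : ℕ} (hk : 1 ≤ k) (hm : 8 * k ^ 2 + 2 ≤ m) {F : ℕ → ℝ} (hF : Monotone F) {b Δ : ℝ}
    (hb : 1 < b) (hbF : b ≤ F m) (hΔ : (m : ℝ) ≤ Δ) :
    ForcesRatio prob allowDeleted k g F Δ m fun n =>
      Real.logb 2 b / (2 * (Real.logb 2 b + 4)) * (Real.logb 2 n / Real.logb 2 (F (2 * n))) := by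
  have hba : b ≤ F (2 * m) := hbF.trans (hF (by omega))
  set a := F (2 * m) with ha_def
  have ha : 1 ≤ a := by linarith
  have hlb : 0 < Real.logb 2 b := Real.logb_pos one_lt_two hb
  have hla : Real.logb 2 b ≤ Real.logb 2 a := logb_two_mono (by linarith) hba
  have hm2 : (2 : ℝ) ≤ m := by exact_mod_cast (show 2 ≤ m by omega)
  have hlm : 0 ≤ Real.logb 2 (2 * m) := Real.logb_nonneg one_lt_two (by linarith)
  set c := Real.logb 2 b / (2 * (Real.logb 2 b + 4)) with hc
  have hc0 : 0 < c := by positivity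
  set X := c * (Real.logb 2 (2 * m) / Real.logb 2 a) with hX
  have hX0 : 0 ≤ X := mul_nonneg hc0.le (div_nonneg hlm (by linarith))
  have hgrow : (16 * a) ^ ⌊X⌋₊ ≤ √(2 * m) := by
    have h := growth_le_sqrt (r := ⌊X⌋₊) (x := 2 * m) ha le_rfl (by linarith) ?_
    · simpa using h
    calc (⌊X⌋₊ : ℝ) * (4 + 0 + Real.logb 2 a) ≤ X * (4 + Real.logb 2 a) := by
          rw [add_zero]
          exact mul_le_mul_of_nonneg_right (Nat.floor_le hX0) (by linarith)
      _ = Real.logb 2 (2 * m) * (c * (4 + Real.logb 2 a) / Real.logb 2 a) := by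
          rw [hX]; ring
      _ ≤ Real.logb 2 (2 * m) * (1 / 2) := by
          -- The quotient `(4 + logb 2 a) / logb 2 a` is largest at `a = b`, where `c` makes this an
          -- equality.
          refine mul_le_mul_of_nonneg_left ?_ hlm
          rw [div_le_iff₀ (by linarith), hc, div_mul_eq_mul_div, div_le_iff₀ (by linarith)]
          nlinarith
      _ = Real.logb 2 (2 * m) / 2 := by ring
  refine hprob.forcesRatio allowDeleted hk (by omega) ha (fun n hn => hF hn)
    ((succ_le_of_growth ha (hgrow.trans (sqrt_two_mul_le hm2))).trans hΔ) ?_ ?_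
  · have h1 : (k : ℝ) * √(2 * m) ≤ m / 2 := by
      refine mul_sqrt_le two_pos (by linarith) ?_
      have : (8 * k ^ 2 + 2 : ℝ) ≤ m := by exact_mod_cast hm
      nlinarith
    have h2 : (k : ℝ) * (16 * a) ^ ⌊X⌋₊ ≤ k * √(2 * m) := by gcongr
    linarith
  · intro n hn hn'
    have hn0 : (1 : ℝ) ≤ n := by exact_mod_cast (show 1 ≤ n by omega)
    have h1 : Real.logb 2 n ≤ Real.logb 2 (2 * m) :=
      logb_two_mono (by linarith) (by exact_mod_cast hn')
    -- The number `n` at the decisive moment is only known to be at least `m`; hence the argument `2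
    -- * n` in the bound.
    have h2 : Real.logb 2 a ≤ Real.logb 2 (F (2 * n)) :=
      logb_two_mono (by linarith) (hF (by omega))
    calc c * (Real.logb 2 n / Real.logb 2 (F (2 * n))) ≤ X := by
          refine mul_le_mul_of_nonneg_left ?_ hc0.le
          exact div_le_div₀ hlm h1 (by linarith) h2
      _ ≤ ((⌊X⌋₊ + 1 : ℕ) : ℝ) := by
          push_cast
          exact (Nat.lt_floor_add_one X).le

/-- The lower bound that results from the answers to solution-queries. -/
theorem kpClustering_forcesSolutionRatio_log (allowDeleted : Bool) {p : ℝ} (hp : 0 ≤ p)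
    {k g m : ℕ} (hk : 1 ≤ k) (hm : 8 * g ^ 2 + 2 ≤ m) {F : ℕ → ℝ} (hF : Monotone F)
    (hF1 : ∀ n, 1 ≤ F n) {Δ : ℝ} (hΔ : (m : ℝ) ≤ Δ) :
    ForcesSolutionRatio (kpClustering p) allowDeleted k g F Δ m fun n =>
      1 / 3 * (Real.logb 2 n / (2 * p + 8 + 2 * Real.logb 2 (F (2 * n)))) ^ p := by
  set a := F (2 * m) with ha_def
  have ha : 1 ≤ a := hF1 _
  have hla : 0 ≤ Real.logb 2 a := Real.logb_nonneg one_lt_two ha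
  have hm2 : (2 : ℝ) ≤ m := by exact_mod_cast (show 2 ≤ m by omega)
  have hlm : 0 ≤ Real.logb 2 (2 * m) := Real.logb_nonneg one_lt_two (by linarith)
  set X := Real.logb 2 (2 * m) / (2 * p + 8 + 2 * Real.logb 2 a) with hX
  have hX0 : 0 ≤ X := div_nonneg hlm (by linarith)
  have hgrow (w : ℝ) (hw : 0 ≤ w) (hwp : w ≤ p) :
      (16 * a) ^ ⌊X⌋₊ * ((⌊X⌋₊ + 1 : ℕ) : ℝ) ^ w ≤ √(2 * m) := by
    refine growth_le_sqrt ha hw (by linarith) ?_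
    calc (⌊X⌋₊ : ℝ) * (4 + w + Real.logb 2 a) ≤ X * (4 + p + Real.logb 2 a) :=
          mul_le_mul (Nat.floor_le hX0) (by linarith) (by linarith) hX0
      _ = Real.logb 2 (2 * m) / 2 := by
          rw [hX]
          have : 2 * p + 8 + 2 * Real.logb 2 a ≠ 0 := by linarith
          field_simp
          ring
  have hgrow0 : (16 * a) ^ ⌊X⌋₊ ≤ √(2 * m) := by simpa using hgrow 0 le_rfl hp
  refine kpClustering_forcesSolutionRatio allowDeleted hp hk (by omega) ha (fun n hn => hF hn)
    (r := ⌊X⌋₊) ((succ_le_of_growth ha (hgrow0.trans (sqrt_two_mul_le hm2))).trans hΔ) ?_ ?_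
  · have h1 : (g : ℝ) * √(2 * m) ≤ m / 2 := by
      refine mul_sqrt_le two_pos (by linarith) ?_
      have : (8 * g ^ 2 + 2 : ℝ) ≤ m := by exact_mod_cast hm
      nlinarith
    rw [mul_assoc]
    exact (mul_le_mul_of_nonneg_left (hgrow p hp le_rfl) (Nat.cast_nonneg g)).trans h1
  · intro n hn hn'
    have hn0 : (1 : ℝ) ≤ n := by exact_mod_cast (show 1 ≤ n by omega)
    have h1 : Real.logb 2 n ≤ Real.logb 2 (2 * m) :=
      logb_two_mono (by linarith) (by exact_mod_cast hn')
    have h2 : Real.logb 2 a ≤ Real.logb 2 (F (2 * n)) :=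
      logb_two_mono (by linarith) (hF (by omega))
    have h3 : Real.logb 2 n / (2 * p + 8 + 2 * Real.logb 2 (F (2 * n))) ≤
        ((⌊X⌋₊ + 1 : ℕ) : ℝ) := by
      refine (div_le_div₀ hlm h1 (show 0 < 2 * p + 8 + 2 * Real.logb 2 a by linarith)
        (by linarith)).trans ?_
      push_cast
      exact (Nat.lt_floor_add_one X).le
    have h4 : 0 ≤ Real.logb 2 n / (2 * p + 8 + 2 * Real.logb 2 (F (2 * n))) :=
      div_nonneg (Real.logb_nonneg one_lt_two hn0) (by linarith)
    linarith [Real.rpow_le_rpow h4 h3 hp]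

/-! ### Constant ratios -/

theorem budget_mono {Sol : Type} {F F' : ℕ → ℝ} (h : ∀ n, F n ≤ F' n) (tr : Transcript Sol) :
    budget F tr ≤ budget F' tr := by
  induction tr with
  | nil => exact le_rfl
  | cons e tr ih =>
    cases e with
    | op o => exact add_le_add ih (h _)
    | _ => exact ih

theorem ForcesRatio.unattainable {prob : Problem} {allowDeleted : Bool} {k g m : ℕ}
    {F F' : ℕ → ℝ} {Δ a : ℝ} {bound : ℕ → ℝ}
    (h : ForcesRatio prob allowDeleted k g F' Δ m bound) (hF : ∀ n, F n ≤ F' n)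
    (ha : ∀ n, m ≤ n → a < bound n) : Unattainable prob allowDeleted k g F a := by
  obtain ⟨A, hA, hA'⟩ := h
  refine ⟨Δ, A, hA, fun alg ⟨h1, h2, h3⟩ => ?_⟩
  obtain ⟨n, hn, -, hle⟩ := hA' alg _ (fun s => (h1 s).trans (budget_mono hF _)) h2 h3
  exact absurd hle (not_le.2 (ha n hn))

theorem ForcesSolutionRatio.forcesRatio {prob : Problem} {allowDeleted : Bool} {k g m : ℕ}
    {F : ℕ → ℝ} {Δ : ℝ} {bound : ℕ → ℝ}
    (h : ForcesSolutionRatio prob allowDeleted k g F Δ m bound) :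
    ForcesRatio prob allowDeleted k g F Δ m bound :=
  h.imp fun _ hA => ⟨hA.1, fun alg α h1 _ h3 => hA.2 alg α h1 h3⟩

/-! ### Query bounds of growth `n ^ o(1)` -/

/-- The least monotone function that is at least `2` and at least `F`. -/
noncomputable def runMax (F : ℕ → ℝ) : ℕ → ℝ
  | 0 => max 2 (F 0)
  | n + 1 => max (runMax F n) (F (n + 1))

theorem runMax_mono (F : ℕ → ℝ) : Monotone (runMax F) :=
  monotone_nat_of_le_succ fun _ => le_max_left _ _

theorem two_le_runMax (F : ℕ → ℝ) (n : ℕ) : 2 ≤ runMax F n :=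
  (le_max_left 2 (F 0)).trans (runMax_mono F (Nat.zero_le n))

theorem le_runMax (F : ℕ → ℝ) (n : ℕ) : F n ≤ runMax F n := by
  cases n <;> exact le_max_right _ _

theorem runMax_le {F : ℕ → ℝ} {n : ℕ} {x : ℝ} (h2 : 2 ≤ x) (h : ∀ i ≤ n, F i ≤ x) :
    runMax F n ≤ x := by
  induction n with
  | zero => exact max_le h2 (h 0 le_rfl)
  | succ n ih => exact max_le (ih fun i hi => h i (by omega)) (h _ le_rfl)

theorem tendsto_logb_natCast : Tendsto (fun n : ℕ => Real.logb 2 (n : ℝ)) atTop atTop :=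
  (Real.tendsto_logb_atTop one_lt_two).comp tendsto_natCast_atTop_atTop

/-- A function of growth `n ^ o(1)` has a logarithm of growth `o(log n)`. -/
theorem eventually_logb_runMax_le {F e : ℕ → ℝ} {h : ℝ} (he : Tendsto e atTop (𝓝 0))
    (hF : ∀ n : ℕ, 1 ≤ n → F n ≤ h * (n : ℝ) ^ e n) (K : ℝ) {ε : ℝ} (hε : 0 < ε) :
    ∀ᶠ n : ℕ in atTop, K + 2 * Real.logb 2 (runMax F (2 * n)) ≤ ε * Real.logb 2 n := by
  -- The term `2 * δ * logb 2 n` uses half of `ε * logb 2 n`; the constants are absorbed by the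
  -- other half.
  set δ := ε / 4 with hδ
  have hδ0 : 0 < δ := by positivity
  obtain ⟨i₀, hi₀⟩ := eventually_atTop.1 (he.eventually (gt_mem_nhds hδ0))
  -- The finite sum covers the indices where the exponent may still be large, and always the index
  -- `0`, where nothing is assumed about `F`.
  set C := 2 + |h| + ∑ i ∈ Finset.range (i₀ + 1), |F i| with hC
  have hsum : 0 ≤ ∑ i ∈ Finset.range (i₀ + 1), |F i| := Finset.sum_nonneg fun i _ => abs_nonneg _
  have hC2 : 2 ≤ C := by linarith [abs_nonneg h]
  have hmax (n : ℕ) (hn : 1 ≤ n) : runMax F n ≤ C * (n : ℝ) ^ δ := by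
    have hn1 : (1 : ℝ) ≤ n := by exact_mod_cast hn
    have hpow : 1 ≤ (n : ℝ) ^ δ := Real.one_le_rpow hn1 hδ0.le
    refine runMax_le (by nlinarith) fun i hi => ?_
    rcases lt_or_ge i (i₀ + 1) with hlt | hge
    · have h1 : |F i| ≤ ∑ i ∈ Finset.range (i₀ + 1), |F i| :=
        Finset.single_le_sum (f := fun i => |F i|) (fun j _ => abs_nonneg _)
          (Finset.mem_range.2 hlt)
      have h2 : F i ≤ C := by linarith [le_abs_self (F i), abs_nonneg h]
      nlinarith
    · have hi1 : (1 : ℝ) ≤ i := by exact_mod_cast (show 1 ≤ i by omega)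
      have h1 : (i : ℝ) ^ e i ≤ (n : ℝ) ^ δ :=
        (Real.rpow_le_rpow_of_exponent_le hi1 (hi₀ i (by omega)).le).trans
          (Real.rpow_le_rpow (by linarith) (by exact_mod_cast hi) hδ0.le)
      calc F i ≤ h * (i : ℝ) ^ e i := hF i (by omega)
        _ ≤ |h| * (i : ℝ) ^ e i := by
            gcongr
            exact le_abs_self h
        _ ≤ C * (n : ℝ) ^ δ := by
            gcongr
            linarith
  filter_upwards [tendsto_logb_natCast.eventually_ge_atTop
    ((K + 2 * (Real.logb 2 C + δ)) / (ε / 2)), eventually_ge_atTop 1] with n hn hn1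
  rw [div_le_iff₀ (by positivity)] at hn
  have hn0 : (0 : ℝ) < n := by exact_mod_cast hn1
  have h1 : Real.logb 2 (runMax F (2 * n)) ≤ Real.logb 2 C + δ * (1 + Real.logb 2 n) := by
    refine (logb_two_mono (by linarith [two_le_runMax F (2 * n)])
      (hmax (2 * n) (by omega))).trans_eq ?_
    push_cast
    rw [Real.logb_mul (by linarith) (by positivity), Real.logb_rpow_eq_mul_logb_of_pos (by positivity),
      Real.logb_mul two_ne_zero hn0.ne', Real.logb_self_eq_one one_lt_two]
  rw [hδ] at h1 hn
  linarith

/-- The second conclusion serves the `p`-th powers: for `1 ≤ x / y` and `1 ≤ p`, the power is at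
least `x / y`. -/
theorem lt_mul_div_of_le {c a x y : ℝ} (hc : 0 < c) (hy : 0 < y)
    (h : y ≤ c / (|a| + c + 1) * x) : a < c * (x / y) ∧ 1 ≤ x / y := by
  have ha : 0 < |a| + c + 1 := by positivity
  rw [div_mul_eq_mul_div, le_div_iff₀ ha] at h
  have h1 : (|a| + c + 1) / c ≤ x / y := by
    rw [div_le_div_iff₀ hc hy]
    linarith
  have h2 : |a| + c + 1 ≤ c * (x / y) := by
    rw [div_le_iff₀ hc] at h1
    linarith
  refine ⟨by linarith [le_abs_self a], le_trans ?_ h1⟩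
  rw [le_div_iff₀ hc]
  linarith [abs_nonneg a]

theorem ValueGap.unattainable {prob : Problem} (hprob : ValueGap prob) (allowDeleted : Bool)
    {k : ℕ} (g : ℕ) (hk : 1 ≤ k) {F e : ℕ → ℝ} {h : ℝ} (he : Tendsto e atTop (𝓝 0))
    (hF : ∀ n : ℕ, 1 ≤ n → F n ≤ h * (n : ℝ) ^ e n) (a : ℝ) :
    Unattainable prob allowDeleted k g F a := by
  set c := Real.logb 2 2 / (2 * (Real.logb 2 2 + 4)) with hc
  have hl2 : Real.logb 2 2 = 1 := Real.logb_self_eq_one one_lt_two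
  have hc0 : 0 < c := by rw [hc, hl2]; norm_num
  obtain ⟨n₀, hn₀⟩ := eventually_atTop.1 (eventually_logb_runMax_le he hF 0
    (show 0 < c / (|a| + c + 1) by positivity))
  refine (hprob.forcesRatio_log allowDeleted (m := max n₀ (8 * k ^ 2 + 2)) hk (le_max_right _ _)
    (runMax_mono F) one_lt_two (two_le_runMax F _) le_rfl).unattainable (le_runMax F) fun n hn => ?_
  have h1 := hn₀ n ((le_max_left _ _).trans hn)
  have h2 : 0 < Real.logb 2 (runMax F (2 * n)) :=
    Real.logb_pos one_lt_two (by linarith [two_le_runMax F (2 * n)])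
  exact (lt_mul_div_of_le hc0 h2 (by linarith)).1

theorem kpClustering_unattainable (allowDeleted : Bool) {p : ℝ} (hp : 1 ≤ p)
    {k : ℕ} (g : ℕ) (hk : 1 ≤ k) {F e : ℕ → ℝ} {h : ℝ} (he : Tendsto e atTop (𝓝 0))
    (hF : ∀ n : ℕ, 1 ≤ n → F n ≤ h * (n : ℝ) ^ e n) (a : ℝ) :
    Unattainable (kpClustering p) allowDeleted k g F a := by
  obtain ⟨n₀, hn₀⟩ := eventually_atTop.1 (eventually_logb_runMax_le he hF (2 * p + 8)
    (show 0 < (1 / 3 : ℝ) / (|a| + 1 / 3 + 1) by positivity))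
  refine (kpClustering_forcesSolutionRatio_log allowDeleted (m := max n₀ (8 * g ^ 2 + 2))
    (by linarith) hk (le_max_right _ _) (runMax_mono F)
    (fun n => one_le_two.trans (two_le_runMax F n)) le_rfl).forcesRatio.unattainable
    (le_runMax F) fun n hn => ?_
  have h1 := hn₀ n ((le_max_left _ _).trans hn)
  have h2 : 0 < Real.logb 2 (runMax F (2 * n)) :=
    Real.logb_pos one_lt_two (by linarith [two_le_runMax F (2 * n)])
  obtain ⟨h3, h4⟩ := lt_mul_div_of_le (by norm_num) (by linarith) h1
  have h5 := Real.rpow_le_rpow_of_exponent_le h4 hp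
  rw [Real.rpow_one] at h5
  linarith

end DynClust

/-! ### The theorem -/

theorem theorem2p5 :
    -- `k`-center, `k`-sum-of-radii, `k`-sum-of-diameters
    (∀ b : ℝ, 1 < b → ∃ c : ℝ, 0 < c ∧ ∀ k B : ℕ, 1 ≤ k → ∃ N : ℕ,
      ∀ f : ℕ → ℕ → ℝ, (∀ j, Monotone (f j)) → (∀ j n, 1 ≤ f j n) →
      ∀ (allowDeleted : Bool) (m : ℕ), N ≤ m → b ≤ f k m → ∀ Δ : ℝ, (m : ℝ) ≤ Δ →
        DynClust.ForcesRatio DynClust.kCenter allowDeleted k (B * k) (f k) Δ m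
          (fun n => c * (Real.logb 2 n / Real.logb 2 (f k (2 * n)))) ∧
        DynClust.ForcesRatio DynClust.kSumRadii allowDeleted k (B * k) (f k) Δ m
          (fun n => c * (Real.logb 2 n / Real.logb 2 (f k (2 * n)))) ∧
        DynClust.ForcesRatio DynClust.kSumDiameters allowDeleted k (B * k) (f k) Δ m
          (fun n => c * (Real.logb 2 n / Real.logb 2 (f k (2 * n))))) ∧
    -- `k`-median, `k`-means, `(k,p)`-clustering
    (∃ c : ℝ, 0 < c ∧ ∀ k B : ℕ, 1 ≤ k → ∃ N : ℕ,
      ∀ f : ℕ → ℕ → ℝ, (∀ j, Monotone (f j)) → (∀ j n, 1 ≤ f j n) →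
      ∀ (allowDeleted : Bool) (m : ℕ), N ≤ m → ∀ Δ : ℝ, (m : ℝ) ≤ Δ →
        DynClust.ForcesSolutionRatio DynClust.kMedian allowDeleted k (B * k) (f k) Δ m
          (fun n => c * (Real.logb 2 n / (10 + 2 * Real.logb 2 (f k (2 * n))))) ∧
        DynClust.ForcesSolutionRatio DynClust.kMeans allowDeleted k (B * k) (f k) Δ m
          (fun n => c * (Real.logb 2 n / (12 + 2 * Real.logb 2 (f k (2 * n)))) ^ 2) ∧
        ∀ p : ℝ, 1 ≤ p →
          DynClust.ForcesSolutionRatio (DynClust.kpClustering p) allowDeleted k (B * k) (f k) Δ m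
            (fun n =>
              c * (Real.logb 2 n / (2 * p + 8 + 2 * Real.logb 2 (f k (2 * n)))) ^ p)) ∧
    -- no constant ratio with `n ^ o(1) * h k` distance queries per operation
    (∀ (f : ℕ → ℕ → ℝ) (h : ℕ → ℝ) (e : ℕ → ℝ), Tendsto e atTop (𝓝 0) →
      (∀ j n : ℕ, 1 ≤ n → f j n ≤ h j * (n : ℝ) ^ e n) →
      ∀ (k B : ℕ) (allowDeleted : Bool) (a : ℝ), 1 ≤ k →
        DynClust.Unattainable DynClust.kCenter allowDeleted k (B * k) (f k) a ∧
        DynClust.Unattainable DynClust.kSumRadii allowDeleted k (B * k) (f k) a ∧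
        DynClust.Unattainable DynClust.kSumDiameters allowDeleted k (B * k) (f k) a ∧
        DynClust.Unattainable DynClust.kMedian allowDeleted k (B * k) (f k) a ∧
        DynClust.Unattainable DynClust.kMeans allowDeleted k (B * k) (f k) a ∧
        ∀ p : ℝ, 1 ≤ p →
          DynClust.Unattainable (DynClust.kpClustering p) allowDeleted k (B * k) (f k) a) := by
  refine ⟨fun b hb => ⟨Real.logb 2 b / (2 * (Real.logb 2 b + 4)), ?_, fun k B hk =>
    ⟨8 * k ^ 2 + 2, fun f hf _ del m hm hbm Δ hΔ =>
      ⟨DynClust.kCenter_valueGap.forcesRatio_log del hk hm (hf k) hb hbm hΔ,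
        DynClust.kSumRadii_valueGap.forcesRatio_log del hk hm (hf k) hb hbm hΔ,
        DynClust.kSumDiameters_valueGap.forcesRatio_log del hk hm (hf k) hb hbm hΔ⟩⟩⟩,
    ⟨1 / 3, by norm_num, fun k B hk => ⟨8 * (B * k) ^ 2 + 2, fun f hf hf1 del m hm Δ hΔ => ?_⟩⟩,
    fun f h e he hf k B del a hk =>
      ⟨DynClust.kCenter_valueGap.unattainable del _ hk he (hf k) a,
        DynClust.kSumRadii_valueGap.unattainable del _ hk he (hf k) a,
        DynClust.kSumDiameters_valueGap.unattainable del _ hk he (hf k) a, ?_, ?_,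
        fun p hp => DynClust.kpClustering_unattainable del hp _ hk he (hf k) a⟩⟩
  · have : 0 < Real.logb 2 b := Real.logb_pos one_lt_two hb
    positivity
  · have key (p : ℝ) (hp : 1 ≤ p) := DynClust.kpClustering_forcesSolutionRatio_log del (p := p)
      (by linarith) hk hm (hf k) (hf1 k) hΔ
    refine ⟨?_, ?_, key⟩
    -- For `p = 1` and `p = 2` the constant `2 * p + 8` is `10` and `12`.
    · have h1 := key 1 le_rfl
      norm_num only [Real.rpow_one] at h1
      rw [DynClust.kMedian_eq]
      convert h1 using 2
    · have h2 := key 2 one_le_two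
      norm_num only [Real.rpow_two] at h2
      rw [DynClust.kMeans_eq]
      convert h2 using 2
  · rw [DynClust.kMedian_eq]
    exact DynClust.kpClustering_unattainable del le_rfl _ hk he (hf k) a
  · rw [DynClust.kMeans_eq]
    exact DynClust.kpClustering_unattainable del one_le_two _ hk he (hf k) a
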